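/- Let $X=(V,E)$ be a connected, finite, simple $3$-valent graph embedded in the plane, the embedding being recorded by the counterclockwise cyclic order of the edges at each vertex: that is, $X$ carries a rotation system whose associated closed oriented surface is the sphere, $|V|-|E|+|F|=2$, where the set $F$ of faces (including the outer one) is the set of closed boundary walks of the rotation system. Assume that the length of the boundary walk of every face (the number of edges surrounding it) is divisible by $3$. For a finite simple graph $G$ let $(\Delta_G f)(p)=\deg(p)f(p)-\sum_{q\sim p}f(q)$ be the Laplacian on $\mathbb C^{V(G)}$; the multiplicity of $\lambda$ is $\dim_{\mathbb C}\ker(\Delta_G-\lambda)$. For $(k,l)\in\mathbb Z^2\setminus\{(0,0)\}$ the Goldberg–Coxeter construction $\mathrm{GC}_{k,l}(X)$ is the following graph. Let $\omega=e^{\pi i/3}$, $z=k+l\omega$, and consider the tiling of $\mathbb C$ by small triangles with vertices $c,\,c+\varepsilon,\,c+\varepsilon\omega$ ($c\in\mathbb Z[\omega]$, $\varepsilon=\pm1$). To each vertex $p$ of $X$ attach a copy of the big triangle $\triangle(0,z,\omega z)$, together with all small triangles meeting its interior, the three edges of $X$ at $p$ corresponding to the three sides in counterclockwise order. For each edge $e$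 of $X$ with endpoints $p,q$, place the big triangle of $p$ at $\triangle(0,z,\omega z)$ and that of $q$ at $\triangle(z,(1+\omega)z,\omega z)$, preserving orientation and so that $e$ corresponds in both to the common side, and identify coinciding small triangles. The vertices of $\mathrm{GC}_{k,l}(X)$ are the small triangles after all these identifications, and two distinct vertices are adjacent if they are represented by small triangles that share an edge and either both meet the interior of the big triangle of one vertex $p$, or, in the above placement for some edge $e$ with endpoints $p,q$, meet the interior of the big triangle of $p$ and of that of $q$, respectively. Then the following hold. 1. The multiplicity of the eigenvalue $4$ of $\Delta_{\mathrm{GC}_{2,0}(X)}$ is at least $3$. 2. For every integer $k\ge 1$, each of $\mathrm{GC}_{k,0}(X)$ and $\mathrm{GC}_{k,k}(X)$ has Laplacian eigenvalue $4$ with multiplicity at least $\lceil k/2\rceil$ and Laplacian eigenvalue $2$ with multiplicity at least $\lfloor k/2\rfloor$ (multiplicity $0$ meaning that it is not an eigenvalue). -/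

import Mathlib

/-! ### Graphs embedded in an oriented surface, and plane graphs -/

/-- An orientation at each vertex of the graph `X`: a cyclic order on the darts (oriented edges)
emanating from each vertex. `rot d` is the dart following `d` in the positive (counterclockwise)
order around the initial vertex of `d`. -/
structure RotationSystem {V : Type*} (X : SimpleGraph V) where
  /-- the successor in the cyclic order around the initial vertex -/
  rot : Equiv.Perm X.Dart
  isCycleOn : ∀ v : V, rot.IsCycleOn {d | d.fst = v}

namespace RotationSystem

variable {V : Type*} {X : SimpleGraph V}

/-- Walking along the boundary of the face on the left of a dart `d`: after traversing `d`, the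
next boundary dart is the one that precedes the reversal of `d` in the counterclockwise order
around the terminal vertex of `d`. -/
def facePerm (R : RotationSystem X) : Equiv.Perm X.Dart :=
  (SimpleGraph.Dart.symm_involutive.toPerm _).trans R.rot.symm

/-- The faces of the embedded graph: the closed boundary walks, i.e. the cycles of `facePerm`.
(The outer face of a plane graph is one of them.) -/
def Face (R : RotationSystem X) : Type _ :=
  Quotient (Equiv.Perm.SameCycle.setoid R.facePerm)

/-- The face on the left of a dart. -/
def leftFace (R : RotationSystem X) (d : X.Dart) : R.Face :=
  Quotient.mk _ d

/-- The number of edges surrounding a face: the length of its boundary walk. -/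
noncomputable def faceLength (R : RotationSystem X) (f : R.Face) : ℕ :=
  Nat.card {d : X.Dart // R.leftFace d = f}

/-- The Euler characteristic of the closed oriented surface obtained by attaching a disc along
each boundary walk. -/
noncomputable def eulerChar (R : RotationSystem X) : ℤ :=
  (Nat.card V : ℤ) - (Nat.card X.edgeSet : ℤ) + (Nat.card R.Face : ℤ)

/-- A connected finite graph with rotation system `R` is a plane graph (equivalently, a graph
embedded in the sphere) with `R` recording the counterclockwise order around each vertex:
the surface carrying the embedding has genus zero. -/
def IsPlane (R : RotationSystem X) : Prop :=
  X.Connected ∧ R.eulerChar = 2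

end RotationSystem

/-! ### The triangular lattice -/

/-- The ring `ℤ[ω]` of Eisenstein integers, `ω ^ 2 = ω - 1`; the element `⟨a, b⟩` is `a + b ω`. -/
abbrev EisensteinInt : Type := QuadraticAlgebra ℤ (-1) 1

namespace EisensteinInt

/-- The primitive sixth root of unity `ω`. -/
def om : EisensteinInt := ⟨0, 1⟩

/-- The embedding of `ℤ[ω]` in `ℂ` with `ω = exp (π i / 3)`. -/
noncomputable def toComplex (x : EisensteinInt) : ℂ :=
  (x.re : ℂ) + (x.im : ℂ) * Complex.exp (Real.pi * Complex.I / 3)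

lemma om_sq : om ^ 2 = om - 1 := by
  ext <;> simp [om, pow_two, QuadraticAlgebra.re_one, QuadraticAlgebra.im_one]

/-- Equality in `ℂ` of real combinations of `1` and `ω` can be checked on coordinates. -/
lemma coord_eq {x y x' y' : ℝ}
    (h : (x : ℂ) + y * Complex.exp (Real.pi * Complex.I / 3) =
      x' + y' * Complex.exp (Real.pi * Complex.I / 3)) : x = x' ∧ y = y' := by
  have hw : (Real.pi * Complex.I / 3 : ℂ) = ((Real.pi / 3 : ℝ) : ℂ) * Complex.I := by
    push_cast; ring
  rw [hw] at h
  have hre := congrArg Complex.re h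
  have him := congrArg Complex.im h
  simp only [Complex.add_re, Complex.add_im, Complex.ofReal_re, Complex.ofReal_im,
    Complex.re_ofReal_mul, Complex.im_ofReal_mul, Complex.exp_ofReal_mul_I_re,
    Complex.exp_ofReal_mul_I_im, zero_add] at hre him
  have hs : Real.sin (Real.pi / 3) ≠ 0 := by
    rw [Real.sin_pi_div_three]; positivity
  have hy : y = y' := mul_right_cancel₀ hs him
  subst hy
  exact ⟨add_right_cancel hre, rfl⟩

end EisensteinInt

open EisensteinInt in
/-- A small triangle of the triangular lattice: the triangle with vertices `c`, `c + ε`, `c + ε ω`,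
where `c` is a lattice point and `ε = 1` (upward triangles) or `ε = -1` (downward triangles). -/
@[ext]
structure SmallTriangle where
  /-- the vertex `c` -/
  base : EisensteinInt
  /-- the sign `ε` -/
  sgn : ℤˣ

/-- The closed triangle with vertices `a`, `b`, `c`, in barycentric coordinates. -/
def closedTriangle (a b c : ℂ) : Set ℂ :=
  {w | ∃ r s t : ℝ, 0 ≤ r ∧ 0 ≤ s ∧ 0 ≤ t ∧ r + s + t = 1 ∧ w = r * a + s * b + t * c}

/-- The interior of the (nondegenerate) triangle with vertices `a`, `b`, `c`, in barycentric
coordinates. -/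
def openTriangle (a b c : ℂ) : Set ℂ :=
  {w | ∃ r s t : ℝ, 0 < r ∧ 0 < s ∧ 0 < t ∧ r + s + t = 1 ∧ w = r * a + s * b + t * c}

namespace SmallTriangle

open EisensteinInt

/-- The sign of a small triangle as an element of `ℤ[ω]`. -/
def e (T : SmallTriangle) : EisensteinInt := ((T.sgn : ℤ) : EisensteinInt)

/-- The set of the three vertices of a small triangle. -/
def verts (T : SmallTriangle) : Finset EisensteinInt :=
  {T.base, T.base + T.e, T.base + T.e * om}

/-- Two small triangles are neighbours if they share exactly one edge. -/
def ShareEdge (T T' : SmallTriangle) : Prop := (T.verts ∩ T'.verts).card = 2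

/-- The region of the plane covered by a small triangle. -/
def region (T : SmallTriangle) : Set ℂ :=
  closedTriangle (toComplex T.base) (toComplex (T.base + T.e)) (toComplex (T.base + T.e * om))

/-- The small triangle meets the interior of the big triangle `△(0, z, ω z)`. -/
def Meets (z : EisensteinInt) (T : SmallTriangle) : Prop :=
  (T.region ∩ openTriangle (toComplex 0) (toComplex z) (toComplex (om * z))).Nonempty

/-- The image of a small triangle under the rotation `x ↦ ω² x + z` by `2π/3` around the
barycenter of `△(0, z, ω z)`, which permutes the corners cyclically: `0 ↦ z ↦ ω z ↦ 0`. -/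
def turn (z : EisensteinInt) (T : SmallTriangle) : SmallTriangle :=
  ⟨om ^ 2 * T.base + z - T.e, T.sgn⟩

lemma verts_turn (z : EisensteinInt) (T : SmallTriangle) :
    (T.turn z).verts = T.verts.image (fun x => om ^ 2 * x + z) := by
  have h0 : (T.turn z).e = T.e := rfl
  have h1 : om ^ 2 * T.base + z = (T.turn z).base + (T.turn z).e := by
    rw [h0]; simp [turn]
  have h2 : om ^ 2 * (T.base + T.e) + z = (T.turn z).base + (T.turn z).e * om := by
    rw [h0]; simp only [turn]; linear_combination T.e * om_sq
  have h3 : om ^ 2 * (T.base + T.e * om) + z = (T.turn z).base := by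
    simp only [turn]; linear_combination (T.e * om + T.e) * om_sq
  simp only [verts, Finset.image_insert, Finset.image_singleton, h1, h2, h3]
  ext x; simp only [Finset.mem_insert, Finset.mem_singleton]; tauto

/-- The image of a small triangle under the half-turn `x ↦ z + ω z - x` around the midpoint of the
edge from `z` to `ω z`, which exchanges the two big triangles `△(0, z, ω z)` and
`△(z, (1 + ω) z, ω z)` on both sides of that edge. -/
def flip (z : EisensteinInt) (T : SmallTriangle) : SmallTriangle :=
  ⟨z + om * z - T.base, -T.sgn⟩

lemma verts_flip (z : EisensteinInt) (T : SmallTriangle) :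
    (T.flip z).verts = T.verts.image (fun x => z + om * z - x) := by
  have h0 : (T.flip z).e = -T.e := by simp [flip, e]
  simp only [verts, Finset.image_insert, Finset.image_singleton, h0]
  congr 1
  · congr 1
    · simp only [flip]; ring
    · simp only [flip]; congr 1; ring

end SmallTriangle

/-! ### The Goldberg-Coxeter construction for 3-valent graphs -/

namespace GoldbergCoxeter

variable {V : Type*} {X : SimpleGraph V}

/-- A cell `(d, T)`: the small triangle `T` of the big triangle `△(0, z, ω z)` attached to the
initial vertex `p` of the dart `d`, where `△(0, z, ω z)` is placed so that `d` corresponds to the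
edge from `z` to `ω z`, and the cyclic order at `p` to the counterclockwise order of the edges. -/
abbrev Cell (X : SimpleGraph V) (z : EisensteinInt) : Type _ :=
  {x : X.Dart × SmallTriangle // x.2.Meets z}

/-- The identifications between cells.
* `turn`: the three darts at a vertex `p` give three placements of the same big triangle. They
  differ by the rotation by `2π/3`: in the placement for `d`, the dart `rot d` corresponds to the
  edge from `ω z` to `0`, which is the image under `turn` of the edge from `z` to `ω z`.
* `glue`: for an edge with darts `d`, `d.symm`, put the big triangle of the initial vertex of `d` on
  `△(0, z, ω z)` and the one of its terminal vertex on `△(z, (1 + ω) z, ω z)`, with the edge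
  corresponding to the common side; overlapping small triangles are identified. -/
inductive Glue (R : RotationSystem X) (z : EisensteinInt) : Cell X z → Cell X z → Prop
  | turn (d : X.Dart) (T : SmallTriangle) (h : (T.turn z).Meets z) (h' : T.Meets z) :
      Glue R z ⟨(d, T.turn z), h⟩ ⟨(R.rot d, T), h'⟩
  | glue (d : X.Dart) (T : SmallTriangle) (h : (T.flip z).Meets z) (h' : T.Meets z) :
      Glue R z ⟨(d, T.flip z), h⟩ ⟨(d.symm, T), h'⟩

/-- The vertices of the Goldberg-Coxeter construction: cells modulo the identifications. -/
def Vertex (R : RotationSystem X) (z : EisensteinInt) : Type _ := Quot (Glue R z)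

/-- Neighbouring small triangles.
* `inside`: two small triangles meeting the same big triangle share an edge.
* `across`: when the big triangles at the two ends of the edge of `d` are put side by side as in
  `Glue.glue`, a small triangle meeting the first one shares an edge with a small triangle meeting
  the second one. -/
inductive Neighbour (R : RotationSystem X) (z : EisensteinInt) :
    Vertex R z → Vertex R z → Prop
  | inside (d : X.Dart) (T T' : SmallTriangle) (h : T.Meets z) (h' : T'.Meets z) :
      T.ShareEdge T' → Neighbour R z (Quot.mk _ ⟨(d, T), h⟩) (Quot.mk _ ⟨(d, T'), h'⟩)
  | across (d : X.Dart) (T T' : SmallTriangle) (h : T.Meets z) (h' : T'.Meets z) :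
      T.ShareEdge (T'.flip z) →
        Neighbour R z (Quot.mk _ ⟨(d, T), h⟩) (Quot.mk _ ⟨(d.symm, T'), h'⟩)

lemma finite_meets (z : EisensteinInt) : {T : SmallTriangle | T.Meets z}.Finite := by
  obtain ⟨k, l⟩ := z
  let N : ℤ := 2 + |k| + |l| + |k + l|
  refine Set.Finite.subset (Set.Finite.image
    (fun p : (ℤ × ℤ) × ℤˣ => (⟨⟨p.1.1, p.1.2⟩, p.2⟩ : SmallTriangle))
    (((Set.finite_Icc (-N) N).prod (Set.finite_Icc (-N) N)).prod Set.finite_univ)) ?_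
  rintro ⟨⟨a, b⟩, e⟩ ⟨w, ⟨r, s, t, hr, hs, ht, h1, rfl⟩, ⟨r', s', t', hr', hs', ht', h1', hw⟩⟩
  simp only [EisensteinInt.toComplex, SmallTriangle.e, EisensteinInt.om] at hw
  simp at hw
  obtain ⟨hx, hy⟩ := EisensteinInt.coord_eq
    (x := (r + s + t) * a + s * (e : ℤ)) (y := (r + s + t) * b + t * (e : ℤ))
    (x' := s' * k - t' * l) (y' := s' * l + t' * (k + l)) (by
      push_cast; linear_combination hw)
  rw [h1, one_mul] at hx hy
  have bd : ∀ u : ℝ, 0 ≤ u → u ≤ 1 → ∀ c : ℝ, |u * c| ≤ |c| := fun u h0 h1 c => by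
    rw [abs_mul, abs_of_nonneg h0]; exact mul_le_of_le_one_left (abs_nonneg c) h1
  have he : |((e : ℤ) : ℝ)| = 1 := by
    rcases Int.units_eq_one_or e with rfl | rfl <;> simp
  have e1 := abs_le.1 ((bd s hs (by linarith) (e : ℤ)).trans he.le)
  have e2 := abs_le.1 ((bd t ht (by linarith) (e : ℤ)).trans he.le)
  have k1 := abs_le.1 (bd s' hs'.le (by linarith) k)
  have l1 := abs_le.1 (bd t' ht'.le (by linarith) l)
  have l2 := abs_le.1 (bd s' hs'.le (by linarith) l)
  have k2 := abs_le.1 (bd t' ht'.le (by linarith) (k + l))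
  have hN : (N : ℝ) = 2 + |(k : ℝ)| + |(l : ℝ)| + |(k : ℝ) + l| := by simp [N]
  have p1 := abs_nonneg (k : ℝ)
  have p2 := abs_nonneg (l : ℝ)
  have p3 := abs_nonneg ((k : ℝ) + l)
  refine ⟨((a, b), e), ⟨⟨⟨?_, ?_⟩, ⟨?_, ?_⟩⟩, Set.mem_univ _⟩, rfl⟩ <;>
  · rw [← Int.cast_le (R := ℝ)]
    push_cast
    linarith

instance [Finite V] : Finite X.Dart :=
  Finite.of_injective _ SimpleGraph.Dart.toProd_injective

instance [Finite V] (R : RotationSystem X) (z : EisensteinInt) : Finite (Vertex R z) := by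
  have : Finite {T : SmallTriangle // T.Meets z} := finite_meets z
  have : Finite (Cell X z) := Finite.of_injective
    (fun x : Cell X z => (x.1.1, (⟨x.1.2, x.2⟩ : {T : SmallTriangle // T.Meets z}))) (by
      rintro ⟨⟨d, T⟩, h⟩ ⟨⟨d', T'⟩, h'⟩ hh
      simpa using hh)
  exact Quot.finite _

end GoldbergCoxeter

/-- The Goldberg-Coxeter construction `GC_{k,l}(X)` of a 3-valent graph `X` equipped with an
orientation `R` at each vertex, with `z = k + l ω`. -/
def goldbergCoxeter {V : Type*} {X : SimpleGraph V} (R : RotationSystem X) (k l : ℤ) :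
    SimpleGraph (GoldbergCoxeter.Vertex R ⟨k, l⟩) :=
  SimpleGraph.fromRel (GoldbergCoxeter.Neighbour R ⟨k, l⟩)

/-! ### The Laplacian -/

open Classical in
/-- The combinatorial Laplacian `(Δ f) p = deg p * f p - ∑ q ∈ N(p), f q` acting on `ℂ^W`. -/
noncomputable def laplacian {W : Type*} [Finite W] (G : SimpleGraph W) :
    (W → ℂ) →ₗ[ℂ] (W → ℂ) :=
  letI := Fintype.ofFinite W
  Matrix.toLin' (G.lapMatrix ℂ)

/-- The multiplicity of `μ` as an eigenvalue of the Laplacian of `G` (zero if `μ` is not an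
eigenvalue). -/
noncomputable def eigenvalueMultiplicity {W : Type*} [Finite W] (G : SimpleGraph W) (μ : ℂ) : ℕ :=
  Module.finrank ℂ (Module.End.eigenspace (laplacian G) μ)

/-! ### Vanishing of the first cohomology of a plane graph -/

namespace RotationSystem

variable {V : Type*} {X : SimpleGraph V}

/-! A plane cubic graph whose face lengths are divisible by 3 maps to the tetrahedron by a local
isomorphism, as a branched cover over the tetrahedron's corners. The tetrahedron is the plane modulo
half turns and translations by `2ℤ[ω]`, so after scaling by `z` the graph `GC_{k,l}(X)` maps to the
hexagonal lattice modulo half turns and translations by `2zℤ[ω]` (the pillow). The map preserves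
neighbourhoods, so every eigenfunction on the pillow pulls back to one on `GC_{k,l}(X)`.

The developing map is built from two coboundary arguments, both resting on
`IsPlane.exists_potential`. Over `ZMod 3`, face lengths divisible by 3 make a cyclic edge colouring
possible (`IsPlane.exists_edge_colouring`); this gives the rotation part. Over `ZMod 2`, applied to
both coordinates of `ℤ[ω]/2`, the edge colours integrate to a vertex colouring
(`IsPlane.exists_vertex_colouring`); this gives the translation part.

On the pillow a triangle with base `c` and sign `ε` is recorded by `ε c` modulo `2z`, and its
neighbours by `-s - u` with `u = 1, ω, 1 + ω`. In the adjacency sum of `(-1)^re * g(im)` two of the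
three terms cancel (`sum_wave`). Thus an even `g` gives Laplacian eigenvalue 4 and an odd `g` gives
2. If `m` divides `z`, any `2m`-periodic `g` descends to the pillow; for `z = k` and `z = k(1 + ω)`
one takes `m = k`. Evaluating on a column of triangles inside one big triangle already gives
multiplicities at least `k` and `k - 1`. For `z = 2` one more row, seen in the adjacent big
triangle, gives the third eigenfunction.

The remaining work is to show that the developing map is a local isomorphism
(`Development.sum_neighborFinset`), that is, that neighbours in the glued graph can be computed in
any one placement. The needed geometry is collected in `IsRegularScale`. -/

lemma leftFace_facePerm (R : RotationSystem X) (d : X.Dart) :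
    R.leftFace (R.facePerm d) = R.leftFace d := by
  apply Quotient.sound
  exact (Equiv.Perm.sameCycle_apply_left (f := R.facePerm)).2 (Equiv.Perm.SameCycle.refl _ _)

lemma facePerm_apply (R : RotationSystem X) (d : X.Dart) :
    R.facePerm d = R.rot.symm d.symm := rfl

lemma rot_fst (R : RotationSystem X) (d : X.Dart) : (R.rot d).fst = d.fst :=
  (R.isCycleOn d.fst).1.mapsTo (x := d) rfl

lemma rot_symm_fst (R : RotationSystem X) (d : X.Dart) : (R.rot.symm d).fst = d.fst := by
  conv_rhs => rw [← R.rot.apply_symm_apply d]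
  rw [rot_fst]

/-- A function on the darts of a connected graph that is invariant under rotation and reversal
is constant. -/
lemma eq_of_invariant (R : RotationSystem X) (hX : X.Connected) {α : Type*} (ψ : X.Dart → α)
    (hrot : ∀ d, ψ (R.rot d) = ψ d) (hsymm : ∀ d, ψ d.symm = ψ d) (d d' : X.Dart) :
    ψ d = ψ d' := by
  have hvert : ∀ d d' : X.Dart, d.fst = d'.fst → ψ d = ψ d' := by
    intro d d' h
    obtain ⟨n, rfl⟩ := (R.isCycleOn d.fst).2 (x := d) rfl (y := d') h.symm
    clear h
    induction n using Int.induction_on with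
    | zero => simp
    | succ n ih => rw [add_comm, zpow_add, zpow_one, Equiv.Perm.mul_apply, hrot, ih]
    | pred n ih =>
      rw [← hrot ((R.rot ^ (-(n : ℤ) - 1)) d), ← Equiv.Perm.mul_apply, ← zpow_one_add]
      simpa using ih
  obtain ⟨p⟩ := hX.preconnected d.fst d'.fst
  generalize hu : d.fst = u at p
  generalize hv : d'.fst = v at p
  induction p generalizing d with
  | nil => exact hvert _ _ (hu.trans hv.symm)
  | @cons u w v h p ih =>
    rw [hvert d ⟨(u, w), h⟩ hu, ← hsymm]
    exact ih _ rfl hv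

open Classical in
/-- The first cohomology of a plane graph vanishes: an antisymmetric function on the darts whose
sum along every face vanishes is a coboundary. -/
theorem IsPlane.exists_potential [Finite V] [Fintype X.Dart] {R : RotationSystem X}
    (hR : R.IsPlane) {K : Type*} [Field K] (c : X.Dart → K) (hsymm : ∀ d, c d.symm = -c d)
    (hface : ∀ h : R.Face → K, ∑ d, h (R.leftFace d) * c d = 0) :
    ∃ p : V → K, ∀ d, c d = p d.snd - p d.fst := by
  obtain ⟨hX, hχ⟩ := hR
  let := Fintype.ofFinite V
  let : Fintype R.Face := @Fintype.ofFinite _ (Quotient.finite _)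
  let : Fintype X.edgeSet := Fintype.ofFinite _
  by_cases hne : Nonempty X.Dart
  swap
  · exact ⟨0, fun d => (hne ⟨d⟩).elim⟩
  obtain ⟨d₀⟩ := hne
  -- The columns of `M` are the linear conditions on a cocycle, one per edge (antisymmetry) and one
  -- per face (zero sum), so the cocycles form the kernel of the transpose.
  let M : Matrix X.Dart (X.edgeSet ⊕ R.Face) K := Matrix.of fun d =>
    Sum.elim (fun e => if d.edge = e then 1 else 0) (fun f => if R.leftFace d = f then 1 else 0)
  let δ : (V → K) →ₗ[K] (X.Dart → K) :=
    { toFun := fun p d => p d.snd - p d.fst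
      map_add' := fun p q => by ext d; simp; ring
      map_smul' := fun a p => by ext d; simp; ring }
  have hM : ∀ x d, (M.mulVec x) d = x (Sum.inl ⟨d.edge, d.edge_mem⟩) + x (Sum.inr (R.leftFace d)) := by
    intro x d
    simp only [Matrix.mulVec, dotProduct, Fintype.sum_sum_type, M, Matrix.of_apply, Sum.elim_inl,
      Sum.elim_inr, ite_mul, one_mul, zero_mul, Finset.sum_ite_eq, Finset.mem_univ, if_true]
    congr 1
    rw [Finset.sum_eq_single ⟨d.edge, d.edge_mem⟩]
    · simp
    · intro e _ he
      rw [if_neg]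
      exact fun h => he (Subtype.ext h.symm)
    · simp
  have hker : ∀ x ∈ LinearMap.ker M.mulVecLin, ∀ d d',
      x (Sum.inr (R.leftFace d)) = x (Sum.inr (R.leftFace d')) := by
    intro x hx
    have hx' : ∀ d : X.Dart,
        x (Sum.inl ⟨d.edge, d.edge_mem⟩) + x (Sum.inr (R.leftFace d)) = 0 := fun d => by
      rw [← hM]; exact congrFun hx d
    have hs : ∀ d : X.Dart, x (Sum.inr (R.leftFace d.symm)) = x (Sum.inr (R.leftFace d)) := by
      intro d
      have h1 := hx' d.symm
      have h2 := hx' d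
      simp only [SimpleGraph.Dart.edge_symm] at h1
      exact add_left_cancel (h1.trans h2.symm)
    -- Invariance under rotation follows from invariance under reversal, since `facePerm` sends the
    -- reversal of `rot d` to `d`.
    refine R.eq_of_invariant hX (fun d => x (Sum.inr (R.leftFace d))) (fun d => ?_) hs
    rw [← hs (R.rot d), ← leftFace_facePerm, facePerm_apply]
    simp
  have hkerM : Module.finrank K (LinearMap.ker M.mulVecLin) ≤ 1 := by
    let w : X.edgeSet ⊕ R.Face → K := Sum.elim (fun _ => -1) (fun _ => 1)
    refine le_trans (Submodule.finrank_mono (t := Submodule.span K {w}) ?_)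
      ((finrank_span_le_card {w}).trans_eq (by simp))
    intro x hx
    rw [Submodule.mem_span_singleton]
    refine ⟨x (Sum.inr (R.leftFace d₀)), ?_⟩
    ext i
    rcases i with ⟨e, he⟩ | f
    · induction e with | h a b =>
      have h1 := congrFun hx ⟨(a, b), he⟩
      change M.mulVec x _ = 0 at h1
      rw [hM, hker x hx _ d₀] at h1
      simp only [w, Pi.smul_apply, Sum.elim_inl, smul_eq_mul, mul_neg, mul_one]
      exact (eq_neg_of_add_eq_zero_left h1).symm
    · obtain ⟨d, rfl⟩ := Quotient.exists_rep f
      exact (mul_one _).trans (hker x hx d₀ d)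
  have hkerδ : Module.finrank K (LinearMap.ker δ) ≤ 1 := by
    refine le_trans (Submodule.finrank_mono (t := Submodule.span K {fun _ => (1 : K)}) ?_)
      ((finrank_span_le_card _).trans_eq (by simp))
    intro p hp
    have hp' : ∀ u v, X.Adj u v → p u = p v := fun u v h =>
      (sub_eq_zero.1 (congrFun hp ⟨(u, v), h⟩)).symm
    rw [Submodule.mem_span_singleton]
    refine ⟨p d₀.fst, ?_⟩
    ext v
    obtain ⟨q⟩ := hX.preconnected d₀.fst v
    simp only [Pi.smul_apply, smul_eq_mul, mul_one]
    generalize d₀.fst = u at q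
    induction q with
    | nil => rfl
    | cons h q ih => rw [hp' _ _ h, ih]
  have hcocycle : ∀ c : X.Dart → K, (∀ d, c d.symm = -c d) →
      (∀ h : R.Face → K, ∑ d, h (R.leftFace d) * c d = 0) →
      c ∈ LinearMap.ker M.transpose.mulVecLin := by
    intro c hsymm hface
    rw [LinearMap.mem_ker]
    ext i
    simp only [Matrix.mulVecLin_apply, Matrix.mulVec, dotProduct, Matrix.transpose_apply, M,
      Matrix.of_apply, Pi.zero_apply]
    rcases i with ⟨e, he⟩ | f
    · induction e with | h a b =>
      let d : X.Dart := ⟨(a, b), he⟩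
      simp only [Sum.elim_inl, ite_mul, one_mul, zero_mul]
      rw [← Finset.sum_filter]
      change ∑ d' with d'.edge = d.edge, c d' = 0
      have hf : (Finset.univ.filter fun d' : X.Dart => d'.edge = d.edge) = {d, d.symm} := by
        ext d'
        simp [SimpleGraph.dart_edge_eq_iff]
      rw [hf, Finset.sum_pair d.symm_ne.symm, hsymm, add_neg_cancel]
    · simpa using hface (fun f' => if f' = f then 1 else 0)
  have hδ : ∀ p, δ p ∈ LinearMap.ker M.transpose.mulVecLin := by
    intro p
    refine hcocycle _ (fun d => by simp [δ]) (fun h => ?_)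
    have key : ∑ d, h (R.leftFace d) * p d.snd = ∑ d, h (R.leftFace d) * p d.fst := by
      refine Fintype.sum_equiv R.facePerm _ _ fun d => ?_
      rw [leftFace_facePerm, facePerm_apply, rot_symm_fst]
      rfl
    simp [δ, mul_sub, key]
  have hle : LinearMap.range δ ≤ LinearMap.ker M.transpose.mulVecLin := by
    rintro _ ⟨p, rfl⟩
    exact hδ p
  have h1 := LinearMap.finrank_range_add_finrank_ker δ
  have h2 := LinearMap.finrank_range_add_finrank_ker M.mulVecLin
  have h3 := LinearMap.finrank_range_add_finrank_ker M.transpose.mulVecLin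
  have h4 : M.transpose.rank = M.rank := Matrix.rank_transpose M
  rw [Matrix.rank, Matrix.rank] at h4
  have h5 : Fintype.card X.Dart = 2 * Fintype.card X.edgeSet := by
    have := X.dart_card_eq_twice_card_edges
    rw [← SimpleGraph.edgeFinset_card]
    convert this
  have h6 : (Fintype.card V : ℤ) - Fintype.card X.edgeSet + Fintype.card R.Face = 2 := by
    rw [← hχ, eulerChar]
    simp only [Nat.card_eq_fintype_card]
  simp only [Module.finrank_fintype_fun_eq_card, Fintype.card_sum] at h1 h2 h3
  -- The rank of `M` is at least `E + F - 1`, so cocycles have dimension at most `2E - (E + F - 1) =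
  -- V - 1` by Euler's formula, while coboundaries have dimension at least `V - 1`.
  have heq := Submodule.eq_of_le_of_finrank_le hle (by omega)
  obtain ⟨p, hp⟩ : c ∈ LinearMap.range δ := heq ▸ hcocycle c hsymm hface
  exact ⟨p, fun d => (congrFun hp d).symm⟩

end RotationSystem

/-! ### Colourings and developing data -/

namespace EisensteinInt

/-- The third roots of unity `1, ω², ω⁴`, indexed by `ZMod 3`. -/
def cubeRoot (n : ZMod 3) : EisensteinInt := om ^ (2 * n.val)

lemma cubeRoot_zero : cubeRoot 0 = 1 := by decide

lemma cubeRoot_add_one (n : ZMod 3) : cubeRoot (n + 1) = om ^ 2 * cubeRoot n := by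
  revert n; decide

end EisensteinInt

namespace RotationSystem

open EisensteinInt

variable {V : Type*} {X : SimpleGraph V}

section

variable [Fintype V] [DecidableRel X.Adj]

lemma card_darts_at (hreg : X.IsRegularOfDegree 3) [DecidableEq V] (v : V) :
    (Finset.univ.filter fun d : X.Dart => d.fst = v).card = 3 := by
  rw [X.dart_fst_fiber_card_eq_degree v, hreg v]

lemma isCycleOn_filter (R : RotationSystem X) [DecidableEq V] (v : V) :
    R.rot.IsCycleOn (Finset.univ.filter fun d : X.Dart => d.fst = v : Finset X.Dart) := by
  simpa using R.isCycleOn v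

lemma rot_pow_three (R : RotationSystem X) (hreg : X.IsRegularOfDegree 3) (d : X.Dart) :
    R.rot (R.rot (R.rot d)) = d := by
  classical
  have h := (R.isCycleOn_filter d.fst).pow_card_apply (a := d) (by simp)
  rw [card_darts_at hreg] at h
  exact h

/-- The darts at each vertex can be numbered modulo `3` in the cyclic order. -/
lemma exists_local_numbering (R : RotationSystem X) (hreg : X.IsRegularOfDegree 3) :
    ∃ φ : X.Dart → ZMod 3, ∀ d, φ (R.rot d) = φ d + 1 := by
  classical
  have hb : ∀ v : V, ∃ d : X.Dart, d.fst = v := by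
    intro v
    have h : 0 < (Finset.univ.filter fun d : X.Dart => d.fst = v).card := by
      rw [card_darts_at hreg]; norm_num
    obtain ⟨d, hd⟩ := Finset.card_pos.1 h
    exact ⟨d, by simpa using hd⟩
  choose b hb using hb
  have hn : ∀ d : X.Dart, ∃ n : ℤ, (R.rot ^ n) (b d.fst) = d := fun d =>
    (R.isCycleOn d.fst).2 (hb d.fst) rfl
  choose n hn using hn
  refine ⟨fun d => (n d : ZMod 3), fun d => ?_⟩
  have h1 : (R.rot ^ n (R.rot d)) (b d.fst) = (R.rot ^ (n d + 1)) (b d.fst) := by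
    rw [add_comm, zpow_add, zpow_one, Equiv.Perm.mul_apply, hn, ← R.rot_fst d, hn]
  have h2 := ((R.isCycleOn_filter d.fst).zpow_apply_eq_zpow_apply (by simp [hb])).1 h1
  rw [card_darts_at hreg] at h2
  have h3 := (ZMod.intCast_eq_intCast_iff _ _ 3).2 h2
  push_cast at h3
  exact h3

lemma sum_comp_leftFace {R : RotationSystem X} (hface : ∀ f : R.Face, 3 ∣ R.faceLength f)
    (h : R.Face → ZMod 3) : ∑ d, h (R.leftFace d) = 0 := by
  classical
  rw [Finset.sum_comp h R.leftFace]
  refine Finset.sum_eq_zero fun f _ => ?_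
  have := hface f
  rw [faceLength, Nat.card_eq_fintype_card, Fintype.card_subtype] at this
  rw [nsmul_eq_mul, (ZMod.natCast_eq_zero_iff _ 3).2 this, zero_mul]

/-- The edges can be coloured with three colours which occur in the cyclic order at each
vertex. -/
lemma IsPlane.exists_edge_colouring {R : RotationSystem X} (hreg : X.IsRegularOfDegree 3)
    (hplane : R.IsPlane) (hface : ∀ f : R.Face, 3 ∣ R.faceLength f) :
    ∃ φ : X.Dart → ZMod 3, (∀ d, φ (R.rot d) = φ d + 1) ∧ ∀ d, φ d.symm = φ d := by
  obtain ⟨φ, hφ⟩ := R.exists_local_numbering hreg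
  have : Fact (Nat.Prime 3) := ⟨Nat.prime_three⟩
  -- Since `φ d.symm = φ (facePerm d) + 1`, the sum of `φ d - φ d.symm` around a face telescopes to
  -- minus its length, which is zero modulo 3. The potential then corrects the numbering at each
  -- vertex.
  obtain ⟨p, hp⟩ := hplane.exists_potential (fun d => φ d - φ d.symm) (fun d => by simp)
    (fun h => by
      have h1 : ∀ d : X.Dart, φ d.symm = φ (R.facePerm d) + 1 := fun d => by
        rw [facePerm_apply, ← hφ, Equiv.apply_symm_apply]
      have h2 : ∑ d, h (R.leftFace d) * φ (R.facePerm d) = ∑ d, h (R.leftFace d) * φ d :=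
        Fintype.sum_equiv R.facePerm _ _ fun d => by rw [leftFace_facePerm]
      simp only [h1, mul_sub, mul_add, mul_one, Finset.sum_sub_distrib, Finset.sum_add_distrib, h2,
        sum_comp_leftFace hface]
      ring)
  refine ⟨fun d => φ d + p d.fst, fun d => ?_, fun d => ?_⟩
  · simp only [hφ, rot_fst]; ring
  · have := hp d
    change φ d.symm + p d.snd = φ d + p d.fst
    linear_combination -this

/-- Given a cyclic edge colouring, the vertices can be coloured by `ℤ[ω]/2`, such that the colours
of adjacent vertices differ by the colour of the edge. -/
lemma IsPlane.exists_vertex_colouring {R : RotationSystem X} (hplane : R.IsPlane)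
    {φ : X.Dart → ZMod 3} (hrot : ∀ d, φ (R.rot d) = φ d + 1) (hsymm : ∀ d, φ d.symm = φ d) :
    ∃ m : V → EisensteinInt, ∀ d : X.Dart, 2 ∣ m d.snd - m d.fst - cubeRoot (φ d + 1) := by
  have e1 : ∀ n : ZMod 3, ((cubeRoot (n - 1 + 1)).re : ZMod 2) = (cubeRoot (n + 1)).im := by
    decide
  have e2 : ∀ n : ZMod 3, ((cubeRoot (n - 1 + 1)).im : ZMod 2) =
      -(cubeRoot (n + 1)).re - (cubeRoot (n + 1)).im := by decide
  have neg : ∀ x : ZMod 2, x = -x := by decide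
  have : Fact (Nat.Prime 2) := ⟨Nat.prime_two⟩
  have hface : ∀ d, φ (R.facePerm d) = φ d - 1 := fun d => by
    rw [eq_sub_iff_add_eq, facePerm_apply, ← hrot, Equiv.apply_symm_apply, hsymm]
  have hsum : ∀ h : R.Face → ZMod 2,
      ∑ d, h (R.leftFace d) * ((cubeRoot (φ d + 1)).re : ZMod 2) = 0 ∧
      ∑ d, h (R.leftFace d) * ((cubeRoot (φ d + 1)).im : ZMod 2) = 0 := by
    intro h
    -- The colour drops by one at each step along a face, so the weighted sum of the roots of unity
    -- is fixed by multiplication by `ω⁻²`. As `1 - ω⁻²` has norm 3, it is a unit modulo 2 and the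
    -- sum vanishes there.
    have key : ∀ g : ZMod 3 → ZMod 2, ∑ d, h (R.leftFace d) * g (φ d - 1) =
        ∑ d, h (R.leftFace d) * g (φ d) := fun g =>
      Fintype.sum_equiv R.facePerm _ _ fun d => by rw [leftFace_facePerm, hface]
    have h1 := key fun n => ((cubeRoot (n + 1)).re : ZMod 2)
    have h2 := key fun n => ((cubeRoot (n + 1)).im : ZMod 2)
    simp only [e1] at h1
    simp only [e2, mul_sub, mul_neg, Finset.sum_sub_distrib, Finset.sum_neg_distrib] at h2
    have two : (2 : ZMod 2) = 0 := rfl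
    generalize ∑ d, h (R.leftFace d) * ((cubeRoot (φ d + 1)).re : ZMod 2) = a at *
    generalize ∑ d, h (R.leftFace d) * ((cubeRoot (φ d + 1)).im : ZMod 2) = b at *
    exact ⟨by linear_combination -h2 - b * two, by linear_combination h1 - h2 - b * two⟩
  obtain ⟨p, hp⟩ := hplane.exists_potential (fun d => ((cubeRoot (φ d + 1)).re : ZMod 2))
    (fun d => by rw [hsymm]; exact neg _) fun h => (hsum h).1
  obtain ⟨q, hq⟩ := hplane.exists_potential (fun d => ((cubeRoot (φ d + 1)).im : ZMod 2))
    (fun d => by rw [hsymm]; exact neg _) fun h => (hsum h).2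
  refine ⟨fun v => ⟨(p v).val, (q v).val⟩, fun d => ?_⟩
  have lift : ∀ (a b : ZMod 2) (c : ℤ), (c : ZMod 2) = a - b → (2 : ℤ) ∣ a.val - b.val - c := by
    intro a b c h
    refine (ZMod.intCast_zmod_eq_zero_iff_dvd _ 2).1 ?_
    push_cast
    simp [h]
  obtain ⟨x, hx⟩ := lift _ _ _ (hp d)
  obtain ⟨y, hy⟩ := lift _ _ _ (hq d)
  refine ⟨⟨x, y⟩, ?_⟩
  rw [two_mul]
  ext
  · simpa [two_mul] using hx
  · simpa [two_mul] using hy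

/-- The data of the developing map: the linear part `ω ^ (2 φ)` and the translation part `t`
(modulo `2`) of the placements of the big triangles. -/
theorem IsPlane.exists_development {R : RotationSystem X} (hreg : X.IsRegularOfDegree 3)
    (hplane : R.IsPlane) (hface : ∀ f : R.Face, 3 ∣ R.faceLength f) :
    ∃ (φ : X.Dart → ZMod 3) (t : X.Dart → EisensteinInt), (∀ d, φ (R.rot d) = φ d + 1) ∧
      (∀ d, φ d.symm = φ d) ∧ (∀ d, 2 ∣ t (R.rot d) - t d - cubeRoot (φ d)) ∧
      (∀ d, 2 ∣ t d.symm - t d - cubeRoot (φ d) * (1 + om)) ∧ ∃ d, φ d = 0 ∧ t d = 0 := by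
  obtain ⟨φ, hrot, hsymm⟩ := hplane.exists_edge_colouring hreg hface
  obtain ⟨m, hm⟩ := hplane.exists_vertex_colouring hrot hsymm
  obtain ⟨d₀, hd₀⟩ : ∃ d₀, φ d₀ = 0 := by
    have h3 : 0 < Fintype.card X.Dart := by
      classical
      obtain ⟨v⟩ := hplane.1.nonempty
      exact lt_of_lt_of_le (by rw [card_darts_at hreg v]; norm_num)
        (Finset.card_filter_le _ fun d : X.Dart => d.fst = v)
    obtain ⟨d⟩ := Fintype.card_pos_iff.1 h3
    have : ∀ n : ZMod 3, n = 0 ∨ n + 1 = 0 ∨ n + 1 + 1 = 0 := by decide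
    rcases this (φ d) with h | h | h
    · exact ⟨d, h⟩
    · exact ⟨R.rot d, by rw [hrot, h]⟩
    · exact ⟨R.rot (R.rot d), by rw [hrot, hrot, h]⟩
  -- The two congruences come down to `ω⁴ - ω² = 1 - 2ω ≡ 1` and `ω² = ω - 1 ≡ 1 + ω` modulo 2.
  -- Subtracting `t d₀` puts the big triangle of `d₀` in standard position.
  let t : X.Dart → EisensteinInt := fun d => m d.fst + cubeRoot (φ d + 1)
  refine ⟨φ, fun d => t d - t d₀, hrot, hsymm, fun d => ?_, fun d => ?_, d₀, hd₀, sub_self _⟩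
  · refine ⟨-om * cubeRoot (φ d), ?_⟩
    simp only [t, rot_fst, hrot, cubeRoot_add_one]
    linear_combination (cubeRoot (φ d) * (om ^ 2 + om - 1)) * om_sq
  · obtain ⟨x, hx⟩ := hm d
    refine ⟨x - cubeRoot (φ d), ?_⟩
    have : d.symm.fst = d.snd := rfl
    simp only [t, hsymm, cubeRoot_add_one, this] at hx ⊢
    linear_combination hx + cubeRoot (φ d) * om_sq
end

end RotationSystem

/-! ### Small triangles: neighbours, symmetries and position relative to a big triangle -/

namespace SmallTriangle

open EisensteinInt

/-- The three units `1, ω, 1 + ω` by which the base points of neighbouring triangles differ. -/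
def step : Fin 3 → EisensteinInt := ![1, om, 1 + om]

/-- The three neighbours of a small triangle. -/
def nbr (T : SmallTriangle) (i : Fin 3) : SmallTriangle := ⟨T.base + T.e * step i, -T.sgn⟩

lemma card_inter_image {f : EisensteinInt → EisensteinInt} (hf : Function.Injective f)
    (A B : Finset EisensteinInt) : (A.image f ∩ B.image f).card = (A ∩ B).card := by
  rw [← Finset.image_inter _ _ hf, Finset.card_image_of_injective _ hf]

lemma om_mul_om_mul (x : EisensteinInt) : om ^ 2 * (-om * x) = x := by
  linear_combination (-om - 1) * x * om_sq

lemma shareEdge_turn (z : EisensteinInt) (T T' : SmallTriangle) :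
    (T.turn z).ShareEdge (T'.turn z) ↔ T.ShareEdge T' := by
  have hf : Function.Injective fun x : EisensteinInt => om ^ 2 * x + z := by
    intro x y h
    have h1 : om ^ 2 * x = om ^ 2 * y := add_right_cancel h
    rw [← om_mul_om_mul x, ← om_mul_om_mul y]
    linear_combination (-om) * h1
  rw [ShareEdge, verts_turn, verts_turn, card_inter_image hf, ShareEdge]

lemma shareEdge_flip (z : EisensteinInt) (T T' : SmallTriangle) :
    (T.flip z).ShareEdge (T'.flip z) ↔ T.ShareEdge T' := by
  have hf : Function.Injective fun x : EisensteinInt => z + om * z - x := sub_right_injective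
  rw [ShareEdge, verts_flip, verts_flip, card_inter_image hf, ShareEdge]

lemma ShareEdge.symm {T T' : SmallTriangle} (h : T.ShareEdge T') : T'.ShareEdge T := by
  rwa [ShareEdge, Finset.inter_comm]

lemma flip_flip (z : EisensteinInt) (T : SmallTriangle) : (T.flip z).flip z = T := by
  ext1 <;> simp [flip]

lemma turn_turn_turn (z : EisensteinInt) (T : SmallTriangle) :
    ((T.turn z).turn z).turn z = T := by
  ext1
  · have : ∀ T : SmallTriangle, (T.turn z).e = T.e := fun _ => rfl
    simp only [turn, e]
    linear_combination ((om ^ 4 + om ^ 3 - om - 1) * T.base +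
      (om ^ 2 + om + 1) * (z - ((T.sgn : ℤ) : EisensteinInt))) * om_sq
  · rfl

lemma turn_mk (k l a b : ℤ) (ε : ℤˣ) :
    (⟨⟨a, b⟩, ε⟩ : SmallTriangle).turn ⟨k, l⟩ = ⟨⟨-a - b + k - ε, a + l⟩, ε⟩ := by
  ext1
  · ext <;> simp [turn, om, e, pow_two]
    ring
  · rfl

lemma flip_mk (k l a b : ℤ) (ε : ℤˣ) :
    (⟨⟨a, b⟩, ε⟩ : SmallTriangle).flip ⟨k, l⟩ = ⟨⟨k - l - a, k + 2 * l - b⟩, -ε⟩ := by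
  ext1
  · ext <;> simp [flip, om] <;> ring
  · rfl

lemma nbr_mk (a b : ℤ) (ε : ℤˣ) (i : Fin 3) :
    (⟨⟨a, b⟩, ε⟩ : SmallTriangle).nbr i =
      ⟨⟨a + ε * (step i).re, b + ε * (step i).im⟩, -ε⟩ := by
  ext1
  · ext <;> simp [nbr, e]
  · rfl

lemma verts_mk (a b : ℤ) (ε : ℤˣ) :
    (⟨⟨a, b⟩, ε⟩ : SmallTriangle).verts = {⟨a, b⟩, ⟨a + ε, b⟩, ⟨a, b + ε⟩} := by
  simp only [verts, e]
  congr 1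
  congr 1
  · ext <;> simp
  · congr 1; ext <;> simp [om]

lemma step_cases (i : Fin 3) : ((step i).re = 1 ∧ (step i).im = 0) ∨
    ((step i).re = 0 ∧ (step i).im = 1) ∨ ((step i).re = 1 ∧ (step i).im = 1) := by
  revert i; decide

lemma verts_translate (c : EisensteinInt) (T : SmallTriangle) :
    verts ⟨c + T.base, T.sgn⟩ = T.verts.image (c + ·) := by
  simp only [verts, e, Finset.image_insert, Finset.image_singleton, add_assoc]

lemma shareEdge_nbr (T : SmallTriangle) (i : Fin 3) : T.ShareEdge (T.nbr i) := by
  have h : ∀ (ε : ℤˣ) (i : Fin 3),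
      (verts ⟨0, ε⟩ ∩ verts ⟨((ε : ℤ) : EisensteinInt) * step i, -ε⟩).card = 2 := by
    decide
  have h1 := verts_translate T.base ⟨0, T.sgn⟩
  have h2 := verts_translate T.base ⟨((T.sgn : ℤ) : EisensteinInt) * step i, -T.sgn⟩
  simp only [add_zero] at h1
  have h3 := h T.sgn i
  rw [← card_inter_image (add_right_injective T.base), ← h1, ← h2] at h3
  exact h3

lemma card_verts (T : SmallTriangle) : T.verts.card = 3 := by
  have h : ∀ ε : ℤˣ, (verts ⟨0, ε⟩).card = 3 := by decide
  have h1 := verts_translate T.base ⟨0, T.sgn⟩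
  simp only [add_zero] at h1
  change (verts ⟨T.base, T.sgn⟩).card = 3
  rw [h1, Finset.card_image_of_injective _ (add_right_injective T.base), h]

/-- Two common vertices between triangles of the same sign would force equal bases, hence three
common vertices. For opposite signs only the three reflections across sides remain. -/
lemma shareEdge_iff {T T' : SmallTriangle} : T.ShareEdge T' ↔ ∃ i, T' = T.nbr i := by
  constructor
  swap
  · rintro ⟨i, rfl⟩
    exact shareEdge_nbr T i
  obtain ⟨⟨a, b⟩, ε⟩ := T
  obtain ⟨⟨a', b'⟩, ε'⟩ := T'
  intro hs
  suffices h : ε' = -ε ∧ ((a' = a + ε ∧ b' = b) ∨ (a' = a ∧ b' = b + ε) ∨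
      (a' = a + ε ∧ b' = b + ε)) by
    obtain ⟨rfl, ⟨rfl, rfl⟩ | ⟨rfl, rfl⟩ | ⟨rfl, rfl⟩⟩ := h
    · exact ⟨0, by rw [nbr_mk]; simp [step, QuadraticAlgebra.re_one, QuadraticAlgebra.im_one]⟩
    · exact ⟨1, by rw [nbr_mk]; simp [step, om]⟩
    · exact ⟨2, by rw [nbr_mk]; simp [step, om, QuadraticAlgebra.re_one, QuadraticAlgebra.im_one]⟩
  obtain ⟨⟨x1, x2⟩, ⟨y1, y2⟩, hxy, h⟩ := Finset.card_eq_two.1 hs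
  have hx : (⟨x1, x2⟩ : EisensteinInt) ∈ (verts ⟨⟨a, b⟩, ε⟩ ∩ verts ⟨⟨a', b'⟩, ε'⟩) := by simp [h]
  have hy : (⟨y1, y2⟩ : EisensteinInt) ∈ (verts ⟨⟨a, b⟩, ε⟩ ∩ verts ⟨⟨a', b'⟩, ε'⟩) := by simp [h]
  clear h
  simp only [verts_mk, Finset.mem_inter, Finset.mem_insert, Finset.mem_singleton,
    QuadraticAlgebra.mk.injEq, ne_eq] at hx hy hxy
  rcases Int.units_eq_one_or ε with rfl | rfl <;> rcases Int.units_eq_one_or ε' with rfl | rfl <;>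
    simp only [Units.val_one, Units.val_neg] at hx hy ⊢
  · exfalso
    obtain ⟨rfl, rfl⟩ : a' = a ∧ b' = b := by omega
    rw [ShareEdge, Finset.inter_self, card_verts] at hs
    omega
  · exact ⟨trivial, by omega⟩
  · exact ⟨by simp, by omega⟩
  · exfalso
    obtain ⟨rfl, rfl⟩ : a' = a ∧ b' = b := by omega
    rw [ShareEdge, Finset.inter_self, card_verts] at hs
    omega

lemma meets_mk_iff (k l a b : ℤ) (ε : ℤˣ) :
    Meets ⟨k, l⟩ ⟨⟨a, b⟩, ε⟩ ↔ ∃ s t s' t' : ℝ, 0 ≤ s ∧ 0 ≤ t ∧ s + t ≤ 1 ∧ 0 < s' ∧ 0 < t' ∧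
      s' + t' < 1 ∧ a + s * (ε : ℤ) = s' * k - t' * l ∧
      b + t * (ε : ℤ) = s' * l + t' * (k + l) := by
  have hom : om * (⟨k, l⟩ : EisensteinInt) = ⟨-l, k + l⟩ := by ext <;> simp [om]
  constructor
  · rintro ⟨w, ⟨r, s, t, hr, hs, ht, h1, rfl⟩, ⟨r', s', t', hr', hs', ht', h1', hw⟩⟩
    refine ⟨s, t, s', t', hs, ht, by linarith, hs', ht', by linarith, ?_⟩
    rw [hom] at hw
    simp only [toComplex, e, om] at hw
    simp at hw
    refine coord_eq ?_
    have h1c : (r : ℂ) + s + t = 1 := by exact_mod_cast h1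
    push_cast
    linear_combination hw - (a + b * Complex.exp (Real.pi * Complex.I / 3)) * h1c
  · rintro ⟨s, t, s', t', hs, ht, hst, hs', ht', hst', h1, h2⟩
    have h1c : (a : ℂ) + s * (ε : ℤ) = s' * k - t' * l := by exact_mod_cast h1
    have h2c : (b : ℂ) + t * (ε : ℤ) = s' * l + t' * (k + l) := by exact_mod_cast h2
    refine ⟨_, ⟨1 - s - t, s, t, by linarith, hs, ht, by ring, rfl⟩,
      ⟨1 - s' - t', s', t', by linarith, hs', ht', by ring, ?_⟩⟩
    rw [hom]
    simp only [toComplex, e, om]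
    simp
    linear_combination h1c + Complex.exp (Real.pi * Complex.I / 3) * h2c

/-- The inequalities say that the barycentre of the small triangle lies in the big one. The big
triangle is a union of small ones, so the barycentre itself serves as the interior point. -/
lemma meets_zero_iff {k : ℤ} (hk : 1 ≤ k) (a b : ℤ) (ε : ℤˣ) :
    Meets ⟨k, 0⟩ ⟨⟨a, b⟩, ε⟩ ↔
      0 ≤ 3 * a + ε ∧ 0 ≤ 3 * b + ε ∧ 3 * a + 3 * b + 2 * ε ≤ 3 * k := by
  have hkR : (0 : ℝ) < k := by exact_mod_cast hk
  rw [meets_mk_iff]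
  constructor
  · rintro ⟨s, t, s', t', hs, ht, hst, hs', ht', hst', h1, h2⟩
    have p1 := mul_pos hs' hkR
    have p2 := mul_pos ht' hkR
    have p3 := mul_pos (sub_pos.2 hst') hkR
    simp only [Int.cast_zero] at h1 h2
    rcases Int.units_eq_one_or ε with rfl | rfl
    · simp at h1 h2 ⊢
      have q1 : (-1 : ℝ) < a := by linarith
      have q2 : (-1 : ℝ) < b := by linarith
      have q3 : (a + b : ℝ) < k := by linarith
      norm_cast at q1 q2 q3
      omega
    · simp at h1 h2 ⊢
      have q1 : (0 : ℝ) < a := by linarith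
      have q2 : (0 : ℝ) < b := by linarith
      have q3 : (a + b : ℝ) < k + 1 := by linarith
      norm_cast at q1 q2 q3
      omega
  · rintro ⟨h1, h2, h3⟩
    refine ⟨1 / 3, 1 / 3, (a + 1 / 3 * (ε : ℤ)) / k, (b + 1 / 3 * (ε : ℤ)) / k, by norm_num,
      by norm_num, by norm_num, div_pos ?_ hkR, div_pos ?_ hkR, ?_, ?_, ?_⟩
    · rcases Int.units_eq_one_or ε with rfl | rfl
      · have : 0 ≤ a := by simp at h1; omega
        have : (0 : ℝ) ≤ a := by exact_mod_cast this
        simp; linarith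
      · have : 1 ≤ a := by simp at h1; omega
        have : (1 : ℝ) ≤ a := by exact_mod_cast this
        simp; linarith
    · rcases Int.units_eq_one_or ε with rfl | rfl
      · have : 0 ≤ b := by simp at h2; omega
        have : (0 : ℝ) ≤ b := by exact_mod_cast this
        simp; linarith
      · have : 1 ≤ b := by simp at h2; omega
        have : (1 : ℝ) ≤ b := by exact_mod_cast this
        simp; linarith
    · rw [← add_div, div_lt_one hkR]
      rcases Int.units_eq_one_or ε with rfl | rfl
      · have : a + b + 1 ≤ k := by simp at h3; omega
        have : (a + b + 1 : ℝ) ≤ k := by exact_mod_cast this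
        simp; linarith
      · have : a + b ≤ k := by simp at h3; omega
        have : (a + b : ℝ) ≤ k := by exact_mod_cast this
        simp; linarith
    · field_simp; simp
    · field_simp; simp

/-- Again the condition is that the barycentre lies in the closed big triangle, but now it may lie
on a side, which bisects the small triangle. -/
lemma meets_diag_iff {k : ℤ} (hk : 1 ≤ k) (a b : ℤ) (ε : ℤˣ) :
    Meets ⟨k, k⟩ ⟨⟨a, b⟩, ε⟩ ↔
      0 ≤ b - a ∧ 0 ≤ b + 2 * a + ε ∧ a + 2 * b + ε ≤ 3 * k := by
  have hkR : (0 : ℝ) < k := by exact_mod_cast hk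
  rw [meets_mk_iff]
  constructor
  · rintro ⟨s, t, s', t', hs, ht, hst, hs', ht', hst', h1, h2⟩
    have p1 := mul_pos hs' hkR
    have p2 := mul_pos ht' hkR
    have p3 := mul_pos (sub_pos.2 hst') hkR
    rcases Int.units_eq_one_or ε with rfl | rfl
    · simp at h1 h2 ⊢
      have q1 : (-1 : ℝ) < b - a := by linarith
      have q2 : (-2 : ℝ) < b + 2 * a := by linarith
      have q3 : (a + 2 * b : ℝ) < 3 * k := by linarith
      norm_cast at q1 q2 q3
      omega
    · simp at h1 h2 ⊢
      have q1 : (-1 : ℝ) < b - a := by linarith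
      have q2 : (0 : ℝ) < b + 2 * a := by linarith
      have q3 : (a + 2 * b : ℝ) < 3 * k + 2 := by linarith
      norm_cast at q1 q2 q3
      omega
  · rintro ⟨h1, h2, h3⟩
    suffices h : ∃ s t : ℝ, 0 ≤ s ∧ 0 ≤ t ∧ s + t ≤ 1 ∧
        0 < (b + t * (ε : ℤ)) - (a + s * (ε : ℤ)) ∧
        0 < (b + t * (ε : ℤ)) + 2 * (a + s * (ε : ℤ)) ∧
        (a + s * (ε : ℤ)) + 2 * (b + t * (ε : ℤ)) < 3 * k by
      obtain ⟨s, t, hs, ht, hst, e1, e2, e3⟩ := h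
      refine ⟨s, t, ((b + t * (ε : ℤ)) + 2 * (a + s * (ε : ℤ))) / (3 * k),
        ((b + t * (ε : ℤ)) - (a + s * (ε : ℤ))) / (3 * k), hs, ht, hst, by positivity,
        by positivity, ?_, ?_, ?_⟩
      · rw [← add_div, div_lt_one (by positivity)]
        linarith
      · field_simp; ring
      · field_simp; ring
    have main : ∀ p q r : ℤ, p ≤ b - a → q ≤ b + 2 * a → a + 2 * b ≤ r →
        ((p : ℝ) ≤ b - a ∧ (q : ℝ) ≤ b + 2 * a ∧ (a + 2 * b : ℝ) ≤ r) := by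
      intro p q r h1 h2 h3
      exact ⟨by exact_mod_cast h1, by exact_mod_cast h2, by exact_mod_cast h3⟩
    -- At most one inequality is tight, since the corners of the big triangle are lattice points and
    -- no barycentre is. In each tight case the weights move the barycentre off that side to the
    -- inside.
    rcases Int.units_eq_one_or ε with rfl | rfl
    · simp only [Units.val_one] at h2 h3 ⊢
      by_cases c1 : b = a
      · obtain ⟨e1, e2, e3⟩ := main 0 0 (3 * k - 3) (by omega) (by omega) (by omega)
        push_cast at e1 e2 e3 ⊢
        exact ⟨1 / 6, 1 / 3, by norm_num, by norm_num, by norm_num, by linarith, by linarith,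
          by linarith⟩
      by_cases c2 : b + 2 * a + 1 = 0
      · obtain ⟨e1, e2, e3⟩ := main 2 (-1) (3 * k - 2) (by omega) (by omega) (by omega)
        push_cast at e1 e2 e3 ⊢
        exact ⟨1 / 2, 1 / 3, by norm_num, by norm_num, by norm_num, by linarith, by linarith,
          by linarith⟩
      by_cases c3 : a + 2 * b + 1 = 3 * k
      · obtain ⟨e1, e2, e3⟩ := main 1 1 (3 * k - 1) (by omega) (by omega) (by omega)
        push_cast at e1 e2 e3 ⊢
        exact ⟨1 / 3, 1 / 6, by norm_num, by norm_num, by norm_num, by linarith, by linarith,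
          by linarith⟩
      · obtain ⟨e1, e2, e3⟩ := main 1 0 (3 * k - 2) (by omega) (by omega) (by omega)
        push_cast at e1 e2 e3 ⊢
        exact ⟨1 / 3, 1 / 3, by norm_num, by norm_num, by norm_num, by linarith, by linarith,
          by linarith⟩
    · simp only [Units.val_neg, Units.val_one] at h2 h3 ⊢
      by_cases c1 : b = a
      · obtain ⟨e1, e2, e3⟩ := main 0 3 (3 * k) (by omega) (by omega) (by omega)
        push_cast at e1 e2 e3 ⊢
        exact ⟨1 / 3, 1 / 6, by norm_num, by norm_num, by norm_num, by linarith, by linarith,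
          by linarith⟩
      by_cases c2 : b + 2 * a - 1 = 0
      · obtain ⟨e1, e2, e3⟩ := main 1 1 (3 * k - 1) (by omega) (by omega) (by omega)
        push_cast at e1 e2 e3 ⊢
        exact ⟨1 / 6, 1 / 3, by norm_num, by norm_num, by norm_num, by linarith, by linarith,
          by linarith⟩
      by_cases c3 : a + 2 * b - 1 = 3 * k
      · obtain ⟨e1, e2, e3⟩ := main 2 2 (3 * k + 1) (by omega) (by omega) (by omega)
        push_cast at e1 e2 e3 ⊢
        exact ⟨1 / 3, 1 / 2, by norm_num, by norm_num, by norm_num, by linarith, by linarith,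
          by linarith⟩
      · obtain ⟨e1, e2, e3⟩ := main 1 2 (3 * k) (by omega) (by omega) (by omega)
        push_cast at e1 e2 e3 ⊢
        exact ⟨1 / 3, 1 / 3, by norm_num, by norm_num, by norm_num, by linarith, by linarith,
          by linarith⟩

/-- The local combinatorics of the small triangles meeting the big triangle `△(0, z, ω z)` and the
three big triangles next to it. -/
structure IsRegularScale (z : EisensteinInt) : Prop where
  meets_turn : ∀ T : SmallTriangle, (T.turn z).Meets z ↔ T.Meets z
  star : ∀ (T : SmallTriangle) (i : Fin 3), T.Meets z → (T.nbr i).Meets z ∨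
    ((T.nbr i).flip z).Meets z ∨ (((T.nbr i).turn z).flip z).Meets z ∨
    ((((T.nbr i).turn z).turn z).flip z).Meets z
  meets_of_flip : ∀ T : SmallTriangle, (T.flip z).Meets z → ((T.turn z).flip z).Meets z → T.Meets z
  nbr_of_flip : ∀ (T : SmallTriangle) (i : Fin 3), T.Meets z → (T.flip z).Meets z →
    (T.nbr i).Meets z ∨ ((T.nbr i).flip z).Meets z

lemma isRegularScale_zero {k : ℤ} (hk : 1 ≤ k) : IsRegularScale ⟨k, 0⟩ := by
  constructor
  · rintro ⟨⟨a, b⟩, ε⟩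
    simp only [turn_mk, meets_zero_iff hk]
    rcases Int.units_eq_one_or ε with rfl | rfl <;> simp <;> omega
  · rintro ⟨⟨a, b⟩, ε⟩ i
    simp only [turn_mk, nbr_mk, flip_mk, meets_zero_iff hk]
    rcases step_cases i with ⟨h, h'⟩ | ⟨h, h'⟩ | ⟨h, h'⟩ <;> simp only [h, h'] <;>
    rcases Int.units_eq_one_or ε with rfl | rfl <;> simp <;> omega
  · rintro ⟨⟨a, b⟩, ε⟩
    simp only [turn_mk, flip_mk, meets_zero_iff hk]
    rcases Int.units_eq_one_or ε with rfl | rfl <;> simp <;> omega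
  · rintro ⟨⟨a, b⟩, ε⟩ i
    simp only [nbr_mk, flip_mk, meets_zero_iff hk]
    rcases step_cases i with ⟨h, h'⟩ | ⟨h, h'⟩ | ⟨h, h'⟩ <;> simp only [h, h'] <;>
    rcases Int.units_eq_one_or ε with rfl | rfl <;> simp <;> omega

lemma isRegularScale_diag {k : ℤ} (hk : 1 ≤ k) : IsRegularScale ⟨k, k⟩ := by
  constructor
  · rintro ⟨⟨a, b⟩, ε⟩
    simp only [turn_mk, meets_diag_iff hk]
    rcases Int.units_eq_one_or ε with rfl | rfl <;> simp <;> omega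
  · rintro ⟨⟨a, b⟩, ε⟩ i
    simp only [turn_mk, nbr_mk, flip_mk, meets_diag_iff hk]
    rcases step_cases i with ⟨h, h'⟩ | ⟨h, h'⟩ | ⟨h, h'⟩ <;> simp only [h, h'] <;>
    rcases Int.units_eq_one_or ε with rfl | rfl <;> simp <;> omega
  · rintro ⟨⟨a, b⟩, ε⟩
    simp only [turn_mk, flip_mk, meets_diag_iff hk]
    rcases Int.units_eq_one_or ε with rfl | rfl <;> simp <;> omega
  · rintro ⟨⟨a, b⟩, ε⟩ i
    simp only [nbr_mk, flip_mk, meets_diag_iff hk]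
    rcases step_cases i with ⟨h, h'⟩ | ⟨h, h'⟩ | ⟨h, h'⟩ <;> simp only [h, h'] <;>
    rcases Int.units_eq_one_or ε with rfl | rfl <;> simp <;> omega

end SmallTriangle

/-! ### Adjacency in the glued graph, computed in a single placement -/

namespace GoldbergCoxeter

open SmallTriangle EisensteinInt

variable {V : Type*} {X : SimpleGraph V} {R : RotationSystem X} {z : EisensteinInt}

/-- The same small triangle in the placement for the preceding dart at the same vertex. -/
def spin (R : RotationSystem X) (z : EisensteinInt) (y : X.Dart × SmallTriangle) :
    X.Dart × SmallTriangle :=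
  (R.rot.symm y.1, y.2.turn z)

/-- The same small triangle in the placement for the reversed dart. -/
def cross (z : EisensteinInt) (y : X.Dart × SmallTriangle) : X.Dart × SmallTriangle :=
  (y.1.symm, y.2.flip z)

lemma cross_cross (y : X.Dart × SmallTriangle) : cross z (cross z y) = y := by
  simp [cross, SmallTriangle.flip_flip]

/-- The vertex represented by a cell. -/
def cls (R : RotationSystem X) (z : EisensteinInt) (y : X.Dart × SmallTriangle)
    (h : y.2.Meets z) : Vertex R z :=
  Quot.mk _ ⟨y, h⟩

lemma cls_spin (y : X.Dart × SmallTriangle) (h : (spin R z y).2.Meets z) (h' : y.2.Meets z) :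
    cls R z (spin R z y) h = cls R z y h' := by
  obtain ⟨d, T⟩ := y
  obtain ⟨d, rfl⟩ := R.rot.surjective d
  have : spin R z (R.rot d, T) = (d, T.turn z) := by simp [spin]
  refine Eq.trans ?_ (Quot.sound (Glue.turn d T h h'))
  simp only [cls, this]
  rfl

lemma cls_cross (y : X.Dart × SmallTriangle) (h : (cross z y).2.Meets z) (h' : y.2.Meets z) :
    cls R z (cross z y) h = cls R z y h' := by
  obtain ⟨d, T⟩ := y
  exact Quot.sound (Glue.glue d.symm T h h')

/-- `v` is represented by the image of `y` on the other side of the edge of `y.1`. -/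
def Across (R : RotationSystem X) (z : EisensteinInt) (y : X.Dart × SmallTriangle)
    (v : Vertex R z) : Prop :=
  ∃ h, v = cls R z (cross z y) h

/-- `v` is represented by the small triangle `y.2`, placed relative to the dart `y.1`, provided
that it meets the central big triangle or one of the three big triangles next to it. -/
def Sees (R : RotationSystem X) (z : EisensteinInt) (y : X.Dart × SmallTriangle)
    (v : Vertex R z) : Prop :=
  (∃ h, v = cls R z y h) ∨ Across R z y v ∨ Across R z (spin R z y) v ∨
    Across R z (spin R z (spin R z y)) v

/-- `v` is represented by a neighbour of the small triangle `y.2`. -/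
def Near (R : RotationSystem X) (z : EisensteinInt) (y : X.Dart × SmallTriangle)
    (v : Vertex R z) : Prop :=
  ∃ T', y.2.ShareEdge T' ∧ Sees R z (y.1, T') v

lemma Across.eq_cls {y : X.Dart × SmallTriangle} {v : Vertex R z} (hv : Across R z y v)
    (h : y.2.Meets z) : v = cls R z y h := by
  obtain ⟨h', rfl⟩ := hv
  exact cls_cross y h' h

lemma spin_spin_spin (hR : ∀ d, R.rot (R.rot (R.rot d)) = d) (y : X.Dart × SmallTriangle) :
    spin R z (spin R z (spin R z y)) = y := by
  obtain ⟨d, T⟩ := y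
  simp only [spin, turn_turn_turn, Prod.mk.injEq, and_true]
  rw [Equiv.symm_apply_eq, Equiv.symm_apply_eq, Equiv.symm_apply_eq, hR]

lemma Sees.eq_cls (hz : IsRegularScale z) {y : X.Dart × SmallTriangle} {v : Vertex R z}
    (hv : Sees R z y v) (h : y.2.Meets z) : v = cls R z y h := by
  have h1 : (spin R z y).2.Meets z := (hz.meets_turn _).2 h
  have h2 : (spin R z (spin R z y)).2.Meets z := (hz.meets_turn _).2 h1
  rcases hv with ⟨_, rfl⟩ | hv | hv | hv
  · rfl
  · exact hv.eq_cls h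
  · rw [hv.eq_cls h1, cls_spin]
  · rw [hv.eq_cls h2, cls_spin _ _ h1, cls_spin]

lemma Across.meets (hz : IsRegularScale z) {y : X.Dart × SmallTriangle} {v v' : Vertex R z}
    (hv : Across R z y v) (hv' : Across R z (spin R z y) v') : y.2.Meets z := by
  obtain ⟨h, -⟩ := hv
  obtain ⟨h', -⟩ := hv'
  exact hz.meets_of_flip _ h h'

lemma Across.unique {y : X.Dart × SmallTriangle} {v v' : Vertex R z}
    (hv : Across R z y v) (hv' : Across R z y v') : v = v' := by
  obtain ⟨h, rfl⟩ := hv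
  obtain ⟨h', rfl⟩ := hv'
  rfl

/-- If the triangle meets the central big triangle, every reading agrees with the central one.
Otherwise `meets_of_flip` prevents it from meeting two of the outer big triangles, so only one
reading exists. The first and third outer triangles are consecutive because `spin` has order 3. -/
lemma Sees.unique (hz : IsRegularScale z) (hR : ∀ d, R.rot (R.rot (R.rot d)) = d)
    {y : X.Dart × SmallTriangle} {v v' : Vertex R z}
    (hv : Sees R z y v) (hv' : Sees R z y v') : v = v' := by
  by_cases h : y.2.Meets z
  · rw [hv.eq_cls hz h, hv'.eq_cls hz h]
  have h1 : ¬ (spin R z y).2.Meets z := fun h' => h ((hz.meets_turn _).1 h')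
  have h2 : ¬ (spin R z (spin R z y)).2.Meets z := fun h' => h1 ((hz.meets_turn _).1 h')
  have h20 : ∀ {v v' : Vertex R z}, Across R z y v → Across R z (spin R z (spin R z y)) v' →
      False := fun hv hv' =>
    h2 (hv'.meets hz (by rwa [spin_spin_spin hR]))
  rcases hv with ⟨h', -⟩ | hv | hv | hv
  · exact absurd h' h
  · rcases hv' with ⟨h', -⟩ | hv' | hv' | hv'
    · exact absurd h' h
    · exact hv.unique hv'
    · exact absurd (hv.meets hz hv') h
    · exact (h20 hv hv').elim
  · rcases hv' with ⟨h', -⟩ | hv' | hv' | hv'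
    · exact absurd h' h
    · exact absurd (hv'.meets hz hv) h
    · exact hv.unique hv'
    · exact absurd (hv.meets hz hv') h1
  · rcases hv' with ⟨h', -⟩ | hv' | hv' | hv'
    · exact absurd h' h
    · exact (h20 hv' hv).elim
    · exact absurd (hv'.meets hz hv) h1
    · exact hv.unique hv'

lemma Sees.of_spin (hz : IsRegularScale z) (hR : ∀ d, R.rot (R.rot (R.rot d)) = d)
    {y : X.Dart × SmallTriangle} {v : Vertex R z} (hv : Sees R z (spin R z y) v) :
    Sees R z y v := by
  rcases hv with ⟨h, rfl⟩ | hv | hv | hv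
  · exact Or.inl ⟨(hz.meets_turn _).1 h, cls_spin _ _ _⟩
  · exact Or.inr (Or.inr (Or.inl hv))
  · exact Or.inr (Or.inr (Or.inr hv))
  · rw [spin_spin_spin hR] at hv
    exact Or.inr (Or.inl hv)

lemma exists_sees (hz : IsRegularScale z) {y : X.Dart × SmallTriangle} (h : y.2.Meets z)
    (i : Fin 3) : ∃ v, Sees R z (y.1, y.2.nbr i) v := by
  rcases hz.star y.2 i h with h | h | h | h
  · exact ⟨_, Or.inl ⟨h, rfl⟩⟩
  · exact ⟨_, Or.inr (Or.inl ⟨h, rfl⟩)⟩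
  · exact ⟨_, Or.inr (Or.inr (Or.inl ⟨h, rfl⟩))⟩
  · exact ⟨_, Or.inr (Or.inr (Or.inr ⟨h, rfl⟩))⟩

lemma Near.of_spin (hz : IsRegularScale z) (hR : ∀ d, R.rot (R.rot (R.rot d)) = d)
    {y : X.Dart × SmallTriangle} {v : Vertex R z} (hv : Near R z (spin R z y) v) :
    Near R z y v := by
  obtain ⟨T', hs, hv⟩ := hv
  rw [← turn_turn_turn z T'] at hs hv
  exact ⟨(T'.turn z).turn z, (shareEdge_turn _ _ _).1 hs, Sees.of_spin hz hR hv⟩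

lemma near_spin_iff (hz : IsRegularScale z) (hR : ∀ d, R.rot (R.rot (R.rot d)) = d)
    {y : X.Dart × SmallTriangle} {v : Vertex R z} : Near R z (spin R z y) v ↔ Near R z y v := by
  refine ⟨Near.of_spin hz hR, fun hv => ?_⟩
  rw [← spin_spin_spin (z := z) hR y] at hv
  exact (hv.of_spin hz hR).of_spin hz hR

/-- A triangle lying in both big triangles along an edge has all its neighbours in one or the other,
by `nbr_of_flip`, so both placements see the same neighbours. -/
lemma Near.cross (hz : IsRegularScale z) (hR : ∀ d, R.rot (R.rot (R.rot d)) = d)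
    {y : X.Dart × SmallTriangle} {v : Vertex R z} (h : y.2.Meets z) (h' : (y.2.flip z).Meets z)
    (hv : Near R z y v) : Near R z (cross z y) v := by
  obtain ⟨T', hs, hv⟩ := hv
  refine ⟨T'.flip z, (shareEdge_flip _ _ _).2 hs, ?_⟩
  obtain ⟨i, rfl⟩ := shareEdge_iff.1 hs
  rcases hz.nbr_of_flip _ i h h' with hi | hi
  · have hc := cross_cross (z := z) (y.1, y.2.nbr i)
    rw [hv.eq_cls hz hi]
    refine Or.inr (Or.inl ⟨?_, ?_⟩)
    · change (GoldbergCoxeter.cross z (GoldbergCoxeter.cross z (y.1, y.2.nbr i))).2.Meets z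
      rwa [hc]
    · simp only [cls]
      congr 2
      exact hc.symm
  · exact Or.inl ⟨hi, hv.unique hz hR (Or.inr (Or.inl ⟨hi, rfl⟩))⟩

/-- It suffices to compare the two generators of the gluing: lifting the set of near vertices to the
quotient avoids describing the equivalence relation they generate. -/
lemma near_congr (hz : IsRegularScale z) (hR : ∀ d, R.rot (R.rot (R.rot d)) = d)
    {y y' : X.Dart × SmallTriangle} {h : y.2.Meets z} {h' : y'.2.Meets z}
    (heq : cls R z y h = cls R z y' h') (v : Vertex R z) : Near R z y v ↔ Near R z y' v := by
  let N : Vertex R z → Set (Vertex R z) := Quot.lift (fun x => {v | Near R z x.1 v}) (by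
    rintro _ _ (⟨d, T, h, h'⟩ | ⟨d, T, h, h'⟩) <;> ext v
    · have : spin R z (R.rot d, T) = (d, T.turn z) := by simp [spin]
      change Near R z (d, T.turn z) v ↔ Near R z (R.rot d, T) v
      rw [← this, near_spin_iff hz hR]
    · have hc : cross z (d.symm, T) = (d, T.flip z) := by simp [GoldbergCoxeter.cross]
      have hc' : cross z (d, T.flip z) = (d.symm, T) := by rw [← hc, cross_cross]
      change Near R z (d, T.flip z) v ↔ Near R z (d.symm, T) v
      constructor
      · intro hv
        rw [← hc']
        refine hv.cross hz hR h ?_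
        rwa [SmallTriangle.flip_flip]
      · intro hv
        rw [← hc]
        exact hv.cross hz hR h' h)
  have : N (cls R z y h) = N (cls R z y' h') := by rw [heq]
  exact Set.ext_iff.1 this v

lemma Neighbour.symm {v w : Vertex R z} (h : Neighbour R z v w) : Neighbour R z w v := by
  rcases h with ⟨d, T, T', h, h', hs⟩ | ⟨d, T, T', h, h', hs⟩
  · exact Neighbour.inside d T' T h' h hs.symm
  · have := Neighbour.across (R := R) d.symm T' T h' h (by
      rw [← shareEdge_flip z, SmallTriangle.flip_flip]
      exact hs.symm)
    simpa using this

lemma neighbour_of_across {y : X.Dart × SmallTriangle} {v : Vertex R z} (h : y.2.Meets z)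
    {T' : SmallTriangle} (hs : y.2.ShareEdge T') (hv : Across R z (y.1, T') v) :
    Neighbour R z (cls R z y h) v := by
  obtain ⟨h', rfl⟩ := hv
  exact Neighbour.across y.1 y.2 (T'.flip z) h h' (by rwa [SmallTriangle.flip_flip])

/-- `Neighbour` allows any representatives of the two vertices; here one fixed cell of the first
vertex suffices to find all its neighbours. -/
lemma neighbour_iff (hz : IsRegularScale z) (hR : ∀ d, R.rot (R.rot (R.rot d)) = d)
    {y : X.Dart × SmallTriangle} {v : Vertex R z} (h : y.2.Meets z) :
    Neighbour R z (cls R z y h) v ↔ Near R z y v := by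
  constructor
  · intro hn
    generalize hx : cls R z y h = x at hn
    rcases hn with ⟨d, T, T', h1, h2, hs⟩ | ⟨d, T, T', h1, h2, hs⟩
    · refine (near_congr hz hR (y' := (d, T)) (h' := h1) hx _).2 ?_
      exact ⟨T', hs, Or.inl ⟨h2, rfl⟩⟩
    · refine (near_congr hz hR (y' := (d, T)) (h' := h1) hx _).2 ?_
      refine ⟨T'.flip z, hs, Or.inr (Or.inl ⟨?_, ?_⟩)⟩
      · change ((T'.flip z).flip z).Meets z
        rwa [SmallTriangle.flip_flip]
      · simp only [cls, GoldbergCoxeter.cross, SmallTriangle.flip_flip]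
        rfl
  · rintro ⟨T', hs, ⟨h', rfl⟩ | hv | hv | hv⟩
    · exact Neighbour.inside y.1 y.2 T' h h' hs
    · exact neighbour_of_across h hs hv
    · have h1 : (spin R z y).2.Meets z := (hz.meets_turn _).2 h
      rw [← cls_spin y h1 h]
      exact neighbour_of_across h1 ((shareEdge_turn z _ _).2 hs) hv
    · have h1 : (spin R z y).2.Meets z := (hz.meets_turn _).2 h
      have h2 : (spin R z (spin R z y)).2.Meets z := (hz.meets_turn _).2 h1
      rw [← cls_spin y h1 h, ← cls_spin _ h2 h1]
      exact neighbour_of_across h2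
        ((shareEdge_turn z _ _).2 ((shareEdge_turn z _ _).2 hs)) hv

end GoldbergCoxeter

/-! ### The developing map to the pillow -/

namespace GoldbergCoxeter

open SmallTriangle EisensteinInt

variable {V : Type*} {X : SimpleGraph V} {R : RotationSystem X} {z : EisensteinInt}

/-- The data of a developing map to the plane modulo half turns and translations by `2 z ℤ[ω]`:
the big triangle of `d` is placed by `x ↦ ω ^ (2 φ d) x + z t d`. -/
structure Development (R : RotationSystem X) where
  /-- the exponent of the linear part of the placement -/
  φ : X.Dart → ZMod 3
  /-- the translation part of the placement -/
  t : X.Dart → EisensteinInt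
  φ_rot : ∀ d, φ (R.rot d) = φ d + 1
  φ_symm : ∀ d, φ d.symm = φ d
  t_rot : ∀ d, 2 ∣ t (R.rot d) - t d - cubeRoot (φ d)
  t_symm : ∀ d, 2 ∣ t d.symm - t d - cubeRoot (φ d) * (1 + om)

/-- The invariant of a small triangle under half turns around the origin. -/
def key (T : SmallTriangle) : EisensteinInt := T.e * T.base

/-- The constant term by which rotations act on keys. -/
def offset (n : ZMod 3) : EisensteinInt := if n = 0 then 0 else if n = 1 then -1 else -om

lemma offset_add_one (n : ZMod 3) : offset (n + 1) = offset n - cubeRoot n := by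
  revert n; decide

/-- A rotation by a cube root of unity permutes the three edge directions of a triangle. The offset
enters twice because passing to a neighbour negates the key. -/
lemma exists_perm_step (n : ZMod 3) : ∃ π : Equiv.Perm (Fin 3), ∀ i,
    cubeRoot n * step i - 2 * offset n = step (π i) := by
  revert n; decide

lemma e_mul_e (T : SmallTriangle) : T.e * T.e = 1 := by
  rcases Int.units_eq_one_or T.sgn with h | h <;> simp [e, h]

/-- A translation by `z u` changes the key by `ε z u`; modulo `2z` the sign is invisible, so keys
translate in the same way for both orientations. -/
lemma two_dvd_e_sub_one (T : SmallTriangle) : (2 : EisensteinInt) ∣ T.e - 1 := by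
  rcases Int.units_eq_one_or T.sgn with h | h
  · simp [e, h]
  · exact ⟨-1, by simp [e, h]; norm_num⟩

lemma key_turn (T : SmallTriangle) : key (T.turn z) = om ^ 2 * key T + T.e * z - 1 := by
  have h : (T.turn z).e = T.e := rfl
  rw [key, key, h]
  simp only [turn]
  linear_combination -e_mul_e T

lemma key_flip (T : SmallTriangle) : key (T.flip z) = key T - T.e * (1 + om) * z := by
  have h : (T.flip z).e = -T.e := by simp [SmallTriangle.flip, e]
  rw [key, key, h]
  simp only [SmallTriangle.flip]
  ring

lemma key_nbr (T : SmallTriangle) (i : Fin 3) : key (T.nbr i) = -key T - step i := by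
  have h : (T.nbr i).e = -T.e := by simp [nbr, e]
  rw [key, key, h]
  simp only [nbr]
  linear_combination -step i * e_mul_e T

lemma not_two_dvd_step (i : Fin 3) : ¬ (2 : EisensteinInt) ∣ step i := by
  rintro ⟨x, hx⟩
  have h1 := congrArg QuadraticAlgebra.re hx
  have h2 := congrArg QuadraticAlgebra.im hx
  rw [two_mul] at h1 h2
  simp only [QuadraticAlgebra.re_add, QuadraticAlgebra.im_add] at h1 h2
  rcases step_cases i with h | h | h <;> omega

/-- The three steps are the distinct nonzero classes of `ℤ[ω]/2`. Hence the images of the three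
neighbours already differ modulo 2. -/
lemma not_two_dvd_step_sub {i j : Fin 3} (hij : i ≠ j) :
    ¬ (2 : EisensteinInt) ∣ step i - step j := by
  rintro ⟨x, hx⟩
  have h1 := congrArg QuadraticAlgebra.re hx
  have h2 := congrArg QuadraticAlgebra.im hx
  rw [two_mul] at h1 h2
  simp only [QuadraticAlgebra.re_add, QuadraticAlgebra.im_add, QuadraticAlgebra.re_sub,
    QuadraticAlgebra.im_sub] at h1 h2
  have h : ∀ i j : Fin 3, i ≠ j → (step i).re ≠ (step j).re ∨ (step i).im ≠ (step j).im := by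
    decide
  have := h i j hij
  rcases step_cases i with h | h | h <;> rcases step_cases j with h' | h' | h' <;> omega

/-- The small triangles of the plane modulo half turns and translations around the lattice
generated by `z`. -/
abbrev Pillow (z : EisensteinInt) : Type := EisensteinInt ⧸ Ideal.span {2 * z}

/-- The quotient map to the pillow. -/
abbrev toPillow (z : EisensteinInt) : EisensteinInt →+* Pillow z :=
  Ideal.Quotient.mk (Ideal.span {2 * z})

lemma pillow_eq_iff {x y : EisensteinInt} :
    toPillow z x = toPillow z y ↔ 2 * z ∣ x - y := by
  rw [Ideal.Quotient.eq, Ideal.mem_span_singleton]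

namespace Development

variable (D : Development R)

/-- The developing map on pairs of a dart and a small triangle placed relative to it. -/
def place (z : EisensteinInt) (y : X.Dart × SmallTriangle) : EisensteinInt :=
  cubeRoot (D.φ y.1) * key y.2 + offset (D.φ y.1) + z * D.t y.1

lemma place_turn (d : X.Dart) (T : SmallTriangle) :
    2 * z ∣ D.place z (d, T.turn z) - D.place z (R.rot d, T) := by
  obtain ⟨x, hx⟩ := D.t_rot d
  obtain ⟨y, hy⟩ := two_dvd_e_sub_one T
  refine ⟨cubeRoot (D.φ d) * y - x, ?_⟩
  simp only [place, key_turn, D.φ_rot, cubeRoot_add_one, offset_add_one]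
  linear_combination (cubeRoot (D.φ d) * z) * hy - z * hx

lemma place_flip (d : X.Dart) (T : SmallTriangle) :
    2 * z ∣ D.place z (d, T.flip z) - D.place z (d.symm, T) := by
  obtain ⟨x, hx⟩ := D.t_symm d
  obtain ⟨y, hy⟩ := two_dvd_e_sub_one T
  refine ⟨-cubeRoot (D.φ d) * (1 + om) * (y + 1) - x, ?_⟩
  simp only [place, key_flip, D.φ_symm]
  linear_combination (-cubeRoot (D.φ d) * (1 + om) * z) * hy - z * hx

/-- The developing map on the vertices of the Goldberg-Coxeter construction. -/
def dev (z : EisensteinInt) : Vertex R z → Pillow z :=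
  Quot.lift (fun x => toPillow _ (D.place z x.1)) (by
    rintro _ _ (⟨d, T, h, h'⟩ | ⟨d, T, h, h'⟩)
    · exact pillow_eq_iff.2 (D.place_turn d T)
    · exact pillow_eq_iff.2 (D.place_flip d T))

lemma dev_cls (y : X.Dart × SmallTriangle) (h : y.2.Meets z) :
    D.dev z (cls R z y h) = toPillow _ (D.place z y) := rfl

lemma mk_place_spin (y : X.Dart × SmallTriangle) :
    toPillow z (D.place z (spin R z y)) =
      toPillow _ (D.place z y) := by
  obtain ⟨d, T⟩ := y
  obtain ⟨d, rfl⟩ := R.rot.surjective d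
  have : spin R z (R.rot d, T) = (d, T.turn z) := by simp [spin]
  rw [this]
  exact pillow_eq_iff.2 (D.place_turn d T)

lemma mk_place_cross (y : X.Dart × SmallTriangle) :
    toPillow z (D.place z (cross z y)) =
      toPillow _ (D.place z y) := by
  obtain ⟨d, T⟩ := y
  have := D.place_flip (z := z) d.symm T
  rw [SimpleGraph.Dart.symm_symm] at this
  exact pillow_eq_iff.2 this

lemma dev_of_sees {y : X.Dart × SmallTriangle} {v : Vertex R z} (hv : Sees R z y v) :
    D.dev z v = toPillow _ (D.place z y) := by
  rcases hv with ⟨h, rfl⟩ | ⟨h, rfl⟩ | ⟨h, rfl⟩ | ⟨h, rfl⟩ <;>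
  simp only [dev_cls, mk_place_cross, mk_place_spin]

lemma exists_perm_place_nbr (d : X.Dart) : ∃ π : Equiv.Perm (Fin 3), ∀ (T : SmallTriangle) i,
    toPillow z (D.place z (d, T.nbr i)) =
      toPillow _ (-D.place z (d, T) - step (π i)) := by
  obtain ⟨π, hπ⟩ := exists_perm_step (D.φ d)
  refine ⟨π, fun T i => pillow_eq_iff.2 ⟨D.t d, ?_⟩⟩
  simp only [place, key_nbr, ← hπ]
  ring

open Classical in
/-- The developing map is a local isomorphism of graphs. -/
lemma sum_neighborFinset [Finite V] (hR : ∀ d, R.rot (R.rot (R.rot d)) = d) {k l : ℤ}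
    (hz : IsRegularScale ⟨k, l⟩) [Fintype (Vertex R ⟨k, l⟩)] {M : Type*} [AddCommMonoid M]
    (F : Pillow ⟨k, l⟩ → M) (v : Vertex R ⟨k, l⟩) :
    (goldbergCoxeter R k l).degree v = 3 ∧
    ∑ w ∈ (goldbergCoxeter R k l).neighborFinset v, F (D.dev _ w) =
      ∑ i, F (-D.dev _ v - toPillow _ (step i)) := by
  obtain ⟨⟨y, h⟩, rfl⟩ := Quot.exists_rep v
  change (goldbergCoxeter R k l).degree (cls R _ y h) = 3 ∧
    ∑ w ∈ (goldbergCoxeter R k l).neighborFinset (cls R _ y h), F (D.dev _ w) =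
      ∑ i, F (-D.dev _ (cls R _ y h) - toPillow _ (step i))
  choose w hw using fun i => exists_sees (R := R) hz h i
  obtain ⟨π, hπ⟩ := D.exists_perm_place_nbr (z := ⟨k, l⟩) y.1
  have hdev : ∀ i, D.dev _ (w i) = toPillow _ (-D.place _ y - step (π i)) := fun i => by
    rw [D.dev_of_sees (hw i), hπ]
  -- Multiple edges and loops are excluded in the pillow modulo 2: the classes `-s - step i` differ
  -- from each other and from `s`. So the degree is exactly 3.
  have hinj : Function.Injective w := by
    intro i j hij
    by_contra hne
    have h1 := hdev i
    rw [hij, hdev j, pillow_eq_iff] at h1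
    refine not_two_dvd_step_sub (π.injective.ne hne) ((Dvd.intro (⟨k, l⟩ : EisensteinInt) rfl).trans ?_)
    convert h1 using 1; ring
  have hne : ∀ i, cls R _ y h ≠ w i := by
    intro i hi
    have h1 := hdev i
    rw [← hi, dev_cls, pillow_eq_iff] at h1
    obtain ⟨x, hx⟩ := h1
    refine not_two_dvd_step (π i) ⟨(⟨k, l⟩ : EisensteinInt) * x - D.place ⟨k, l⟩ y, ?_⟩
    linear_combination hx
  have hN : (goldbergCoxeter R k l).neighborFinset (cls R _ y h) = Finset.univ.image w := by
    ext v
    rw [SimpleGraph.mem_neighborFinset, goldbergCoxeter, SimpleGraph.fromRel_adj]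
    have : Neighbour R ⟨k, l⟩ (cls R _ y h) v ∨ Neighbour R ⟨k, l⟩ v (cls R _ y h) ↔
        Near R _ y v := by
      rw [← neighbour_iff hz hR h]
      exact ⟨fun h => h.elim id Neighbour.symm, Or.inl⟩
    rw [this]
    simp only [Finset.mem_image, Finset.mem_univ, true_and]
    constructor
    · rintro ⟨-, T', hs, hv⟩
      obtain ⟨i, rfl⟩ := shareEdge_iff.1 hs
      exact ⟨i, (hw i).unique hz hR hv⟩
    · rintro ⟨i, rfl⟩
      exact ⟨hne i, y.2.nbr i, shareEdge_nbr _ _, hw i⟩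
  refine ⟨by rw [← SimpleGraph.card_neighborFinset_eq_degree, hN,
    Finset.card_image_of_injective _ hinj]; simp, ?_⟩
  rw [hN, Finset.sum_image fun i _ j _ hij => hinj hij]
  simp only [hdev, dev_cls, map_sub, map_neg]
  exact Equiv.sum_comp π fun i => F (-toPillow _ (D.place _ y) -
    toPillow _ (step i))

/-- An eigenfunction on the hexagonal lattice pulls back along the developing map. -/
lemma laplacian_comp_dev [Finite V] (hR : ∀ d, R.rot (R.rot (R.rot d)) = d) {k l : ℤ}
    (hz : IsRegularScale ⟨k, l⟩) (F : Pillow ⟨k, l⟩ → ℂ) (ν : ℂ)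
    (hF : ∀ s, ∑ i, F (-s - toPillow _ (step i)) = ν * F s) :
    laplacian (goldbergCoxeter R k l) (F ∘ D.dev _) = (3 - ν) • (F ∘ D.dev _) := by
  classical
  let _ := Fintype.ofFinite (Vertex R ⟨k, l⟩)
  ext v
  obtain ⟨h1, h2⟩ := D.sum_neighborFinset hR hz F v
  rw [laplacian, Matrix.toLin'_apply]
  have := (goldbergCoxeter R k l).lapMatrix_mulVec_apply v (F ∘ D.dev _)
  rw [h1, Nat.cast_ofNat] at this
  simp only [Function.comp_apply, h2, hF] at this
  simp only [Pi.smul_apply, Function.comp_apply, smul_eq_mul, sub_mul]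
  convert this using 1

end Development

end GoldbergCoxeter

/-! ### Waves on the pillow and the multiplicity bounds -/

lemma le_eigenvalueMultiplicity {W : Type*} [Finite W] (G : SimpleGraph W) (μ : ℂ) {n : ℕ}
    (f : Fin n → W → ℂ) (hf : ∀ j, laplacian G (f j) = μ • f j) (p : Fin n → W)
    (h0 : ∀ i j, i ≠ j → f j (p i) = 0) (h1 : ∀ j, f j (p j) ≠ 0) :
    n ≤ eigenvalueMultiplicity G μ := by
  let f' : Fin n → Module.End.eigenspace (laplacian G) μ := fun j =>
    ⟨f j, Module.End.mem_eigenspace_iff.2 (hf j)⟩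
  have hli : LinearIndependent ℂ f' := by
    rw [Fintype.linearIndependent_iff]
    intro c hc i
    have h := congrFun (congrArg Subtype.val hc) (p i)
    simp only [Submodule.coe_sum, Submodule.coe_smul, f', Finset.sum_apply, Pi.smul_apply,
      smul_eq_mul, Submodule.coe_zero, Pi.zero_apply] at h
    rw [Finset.sum_eq_single i (fun j _ hj => by rw [h0 i j hj.symm, mul_zero]) (by simp)] at h
    exact (mul_eq_zero.1 h).resolve_right (h1 i)
  simpa [eigenvalueMultiplicity] using hli.fintype_card_le_finrank

namespace GoldbergCoxeter

open SmallTriangle EisensteinInt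

/-- The function on the hexagonal lattice (in terms of keys) that alternates along the zigzag rows
parallel to `1`, with amplitude `g`. -/
noncomputable def wave (g : ℤ → ℂ) (s : EisensteinInt) : ℂ := (-1) ^ s.re * g s.im

lemma neg_one_zpow_neg (a : ℤ) : (-1 : ℂ) ^ (-a) = (-1) ^ a := by
  rw [zpow_neg, ← inv_zpow, inv_neg, inv_one]

/-- The neighbours along `ω` and `1 + ω` lie in the same row with real parts of opposite parity, so
they cancel and only the neighbour along `1` contributes. -/
lemma sum_wave (g : ℤ → ℂ) (s : EisensteinInt) :
    ∑ i, wave g (-s - step i) = -((-1) ^ s.re * g (-s.im)) := by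
  have h : (-1 : ℂ) ^ (-s.re - 1) = -(-1) ^ s.re := by
    rw [zpow_sub₀ (by norm_num), zpow_one, neg_one_zpow_neg]; ring
  have hre : ∀ i, (-s - step i).re = -s.re - (step i).re := fun i => rfl
  have him : ∀ i, (-s - step i).im = -s.im - (step i).im := fun i => rfl
  have h0 : (step 0).re = 1 ∧ (step 0).im = 0 := by decide
  have h1 : (step 1).re = 0 ∧ (step 1).im = 1 := by decide
  have h2 : (step 2).re = 1 ∧ (step 2).im = 1 := by decide
  simp only [Fin.sum_univ_three, wave, hre, him, h0, h1, h2, sub_zero, h, neg_one_zpow_neg]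
  ring

/-- A multiple of `2z` is a multiple of `2m`: it changes the real part by an even number and the
imaginary part by a period of `g`. -/
lemma wave_congr {g : ℤ → ℂ} {m : ℤ} {z : EisensteinInt} (hz : (m : EisensteinInt) ∣ z)
    (hg : ∀ b b', 2 * m ∣ b - b' → g b = g b') {s s' : EisensteinInt} (h : 2 * z ∣ s - s') :
    wave g s = wave g s' := by
  obtain ⟨x, hx⟩ := (mul_dvd_mul_left 2 hz).trans h
  have hx' : s - s' = ((2 * m : ℤ) : EisensteinInt) * x := by rw [hx]; push_cast; rfl
  have hre := congrArg QuadraticAlgebra.re hx'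
  have him := congrArg QuadraticAlgebra.im hx'
  simp only [QuadraticAlgebra.re_sub, QuadraticAlgebra.im_sub, QuadraticAlgebra.re_mul,
    QuadraticAlgebra.im_mul, QuadraticAlgebra.re_intCast, QuadraticAlgebra.im_intCast, Int.cast_id] at hre him
  have e1 : s.re = s'.re + 2 * (m * x.re) := by linear_combination hre
  have e2 : s.im - s'.im = 2 * m * x.im := by linear_combination him
  rw [wave, wave, hg s.im s'.im ⟨_, e2⟩, e1, zpow_add₀ (by norm_num), zpow_mul]
  norm_num

variable {V : Type*} {X : SimpleGraph V} {R : RotationSystem X}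

namespace Development

lemma le_multiplicity [Finite V] (D : Development R) (hR : ∀ d, R.rot (R.rot (R.rot d)) = d)
    {k l m : ℤ} (hz : IsRegularScale ⟨k, l⟩) (hm : (m : EisensteinInt) ∣ ⟨k, l⟩) {n : ℕ}
    (g : Fin n → ℤ → ℂ) (ν : ℂ) (hper : ∀ j b b', 2 * m ∣ b - b' → g j b = g j b')
    (hpar : ∀ j b, -g j (-b) = ν * g j b) (p : Fin n → ℤ)
    (hp : ∀ i, ∃ v a, D.dev _ v = toPillow ⟨k, l⟩ ⟨a, p i⟩)
    (h0 : ∀ i j, i ≠ j → g j (p i) = 0) (h1 : ∀ j, g j (p j) ≠ 0) :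
    n ≤ eigenvalueMultiplicity (goldbergCoxeter R k l) (3 - ν) := by
  choose v a hv using hp
  have hF : ∀ j, ∃ F : Pillow ⟨k, l⟩ → ℂ, ∀ s, F (toPillow ⟨k, l⟩ s) = wave (g j) s := by
    intro j
    refine ⟨fun q => wave (g j) (Function.surjInv Ideal.Quotient.mk_surjective q), fun s => ?_⟩
    exact wave_congr hm (hper j)
      (pillow_eq_iff.1 (Function.surjInv_eq Ideal.Quotient.mk_surjective _))
  choose F hF using hF
  refine le_eigenvalueMultiplicity _ _ (fun j => F j ∘ D.dev _) (fun j => ?_) v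
    (fun i j hij => ?_) (fun j => ?_)
  · refine D.laplacian_comp_dev hR hz (F j) ν fun s => ?_
    obtain ⟨s, rfl⟩ := Ideal.Quotient.mk_surjective s
    simp only [← map_neg, ← map_sub, hF, sum_wave]
    rw [wave]
    linear_combination (-1) ^ s.re * hpar j s.im
  · simp only [Function.comp_apply, hv, hF, wave, h0 i j hij, mul_zero]
  · simp only [Function.comp_apply, hv, hF, wave]
    exact mul_ne_zero (zpow_ne_zero _ (by norm_num)) (h1 j)

/-- The classes `±j` modulo `2m` are distinct for `0 ≤ j ≤ m`, so their indicators are up to `m + 1`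
independent even amplitudes. -/
lemma le_multiplicity_four [Finite V] (D : Development R)
    (hR : ∀ d, R.rot (R.rot (R.rot d)) = d)
    {k l m : ℤ} (hz : IsRegularScale ⟨k, l⟩) (hm : (m : EisensteinInt) ∣ ⟨k, l⟩) {n : ℕ}
    (hn : (n : ℤ) ≤ m + 1)
    (hp : ∀ b : ℕ, b < n →
      ∃ v a, D.dev _ v = toPillow ⟨k, l⟩ ⟨a, b⟩) :
    n ≤ eigenvalueMultiplicity (goldbergCoxeter R k l) 4 := by
  classical
  have h := D.le_multiplicity hR hz hm (n := n)
    -- The disjunction also covers the self-opposite classes `0` and `m`, where the two conditions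
    -- coincide.
    (fun j b => if 2 * m ∣ b - (j : ℕ) ∨ 2 * m ∣ b + (j : ℕ) then 1 else 0) (-1) ?_ ?_
    (fun j => (j : ℕ)) (fun i => hp i i.2) ?_ ?_
  · norm_num at h
    exact h
  · intro j b b' hb
    have h1 : 2 * m ∣ b - (j : ℕ) ↔ 2 * m ∣ b' - (j : ℕ) :=
      dvd_iff_dvd_of_dvd_sub (by simpa using hb)
    have h2 : 2 * m ∣ b + (j : ℕ) ↔ 2 * m ∣ b' + (j : ℕ) :=
      dvd_iff_dvd_of_dvd_sub (by simpa using hb)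
    simp only [h1, h2]
  · intro j b
    have h1 : 2 * m ∣ -b - (j : ℕ) ↔ 2 * m ∣ b + (j : ℕ) := by
      rw [← dvd_neg]; ring_nf
    have h2 : 2 * m ∣ -b + (j : ℕ) ↔ 2 * m ∣ b - (j : ℕ) := by
      rw [← dvd_neg]; ring_nf
    simp only [h1, h2, or_comm, neg_one_mul]
  · intro i j hij
    have hne : (i : ℕ) ≠ j := fun h => hij (Fin.ext h)
    have hi := i.2
    have hj := j.2
    rw [if_neg]
    rintro (h | h)
    · have := Int.eq_zero_of_abs_lt_dvd h (by rw [abs_lt]; omega)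
      omega
    · have := Int.eq_zero_of_abs_lt_dvd h (by rw [abs_lt]; omega)
      omega
  · intro j
    simp

/-- Odd amplitudes vanish at the self-opposite classes `0` and `m`, which leaves `1, …, m - 1`;
hence the shift `j + 1` and the bound `n + 1 ≤ m`. -/
lemma le_multiplicity_two [Finite V] (D : Development R)
    (hR : ∀ d, R.rot (R.rot (R.rot d)) = d)
    {k l m : ℤ} (hz : IsRegularScale ⟨k, l⟩) (hm : (m : EisensteinInt) ∣ ⟨k, l⟩) {n : ℕ}
    (hn : (n : ℤ) + 1 ≤ m)
    (hp : ∀ b : ℕ, b < n + 1 →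
      ∃ v a, D.dev _ v = toPillow ⟨k, l⟩ ⟨a, b⟩) :
    n ≤ eigenvalueMultiplicity (goldbergCoxeter R k l) 2 := by
  classical
  have h := D.le_multiplicity hR hz hm (n := n)
    (fun j b => (if 2 * m ∣ b - (j + 1 : ℕ) then 1 else 0) -
      if 2 * m ∣ b + (j + 1 : ℕ) then 1 else 0) 1 ?_ ?_
    (fun j => (j + 1 : ℕ)) (fun i => hp (i + 1) (by omega)) ?_ ?_
  · norm_num at h
    exact h
  · intro j b b' hb
    have h1 : 2 * m ∣ b - (j + 1 : ℕ) ↔ 2 * m ∣ b' - (j + 1 : ℕ) :=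
      dvd_iff_dvd_of_dvd_sub (by simpa using hb)
    have h2 : 2 * m ∣ b + (j + 1 : ℕ) ↔ 2 * m ∣ b' + (j + 1 : ℕ) :=
      dvd_iff_dvd_of_dvd_sub (by simpa using hb)
    simp only [h1, h2]
  · intro j b
    have h1 : 2 * m ∣ -b - (j + 1 : ℕ) ↔ 2 * m ∣ b + (j + 1 : ℕ) := by
      rw [← dvd_neg]; ring_nf
    have h2 : 2 * m ∣ -b + (j + 1 : ℕ) ↔ 2 * m ∣ b - (j + 1 : ℕ) := by
      rw [← dvd_neg]; ring_nf
    simp only [h1, h2]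
    ring
  · intro i j hij
    have hne : (i : ℕ) ≠ j := fun h => hij (Fin.ext h)
    have hi := i.2
    have hj := j.2
    rw [if_neg, if_neg, sub_zero]
    · intro h
      have := Int.eq_zero_of_abs_lt_dvd h (by rw [abs_lt]; omega)
      omega
    · intro h
      have := Int.eq_zero_of_abs_lt_dvd h (by rw [abs_lt]; omega)
      omega
  · intro j
    have hj := j.2
    rw [if_pos (by simp), if_neg]
    · simp
    · intro h
      have := Int.eq_zero_of_abs_lt_dvd h (by rw [abs_lt]; omega)
      omega

lemma exists_dev_eq (D : Development R) {d : X.Dart} (hφ : D.φ d = 0) (ht : D.t d = 0)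
    {z : EisensteinInt} {b : ℤ} (h : Meets z ⟨⟨0, b⟩, 1⟩) :
    ∃ v a, D.dev z v = toPillow z ⟨a, b⟩ := by
  refine ⟨cls R z (d, ⟨⟨0, b⟩, 1⟩) h, 0, ?_⟩
  rw [dev_cls]
  congr 1
  simp [place, hφ, ht, cubeRoot_zero, offset, key, e]

/-- Row `k` is reached from across the edge of `d`: the corner triangle of the adjacent big triangle
has key `-k - kω`, which is congruent to `-k + kω` modulo `2k`. -/
lemma exists_dev_eq_top (D : Development R) {d : X.Dart} (hφ : D.φ d = 0) (ht : D.t d = 0)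
    {k : ℤ} (hk : 1 ≤ k) :
    ∃ v a, D.dev ⟨k, 0⟩ v = toPillow ⟨k, 0⟩ ⟨a, k⟩ := by
  have h : Meets ⟨k, 0⟩ ⟨⟨0, 0⟩, 1⟩ := by
    rw [meets_zero_iff hk]
    simp; omega
  refine ⟨cls R ⟨k, 0⟩ (d.symm, ⟨⟨0, 0⟩, 1⟩) h, -k, ?_⟩
  rw [dev_cls, ← D.mk_place_cross, pillow_eq_iff]
  refine ⟨-om, ?_⟩
  simp only [cross, SimpleGraph.Dart.symm_symm, flip_mk, place, hφ, ht, cubeRoot_zero, offset, key, e]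
  ext
  · simp [om, QuadraticAlgebra.im_ofNat]
  · simp [om, QuadraticAlgebra.re_ofNat, QuadraticAlgebra.im_ofNat]; ring

end Development

end GoldbergCoxeter

open GoldbergCoxeter SmallTriangle in
theorem theorem1p6 {V : Type*} [Fintype V] (X : SimpleGraph V) [DecidableRel X.Adj]
    (hreg : X.IsRegularOfDegree 3) (R : RotationSystem X) (hplane : R.IsPlane)
    (hface : ∀ f : R.Face, 3 ∣ R.faceLength f) :
    3 ≤ eigenvalueMultiplicity (goldbergCoxeter R 2 0) 4 ∧
      ∀ k : ℕ, 1 ≤ k →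
        (⌈(k : ℚ) / 2⌉₊ ≤ eigenvalueMultiplicity (goldbergCoxeter R k 0) 4 ∧
          ⌊(k : ℚ) / 2⌋₊ ≤ eigenvalueMultiplicity (goldbergCoxeter R k 0) 2) ∧
        (⌈(k : ℚ) / 2⌉₊ ≤ eigenvalueMultiplicity (goldbergCoxeter R k k) 4 ∧
          ⌊(k : ℚ) / 2⌋₊ ≤ eigenvalueMultiplicity (goldbergCoxeter R k k) 2) := by
  obtain ⟨φ, t, h1, h2, h3, h4, d, hφ, ht⟩ := hplane.exists_development hreg hface
  let D : Development R := ⟨φ, t, h1, h2, h3, h4⟩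
  have hR := R.rot_pow_three hreg
  have hm0 : ∀ k : ℤ, (k : EisensteinInt) ∣ ⟨k, 0⟩ := fun k => ⟨1, by ext <;> simp⟩
  have hmd : ∀ k : ℤ, (k : EisensteinInt) ∣ ⟨k, k⟩ := fun k =>
    ⟨⟨1, 1⟩, by ext <;> simp⟩
  have p0 : ∀ (k : ℤ) (b : ℕ), 1 ≤ k → (b : ℤ) < k → ∃ v a, D.dev ⟨k, 0⟩ v =
      toPillow ⟨k, 0⟩ ⟨a, b⟩ := fun k b hk hb =>
    D.exists_dev_eq hφ ht (by rw [meets_zero_iff hk]; simp; omega)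
  have pd : ∀ (k : ℤ) (b : ℕ), 1 ≤ k → (b : ℤ) < k → ∃ v a, D.dev ⟨k, k⟩ v =
      toPillow ⟨k, k⟩ ⟨a, b⟩ := fun k b hk hb =>
    D.exists_dev_eq hφ ht (by rw [meets_diag_iff hk]; simp; omega)
  constructor
  · refine D.le_multiplicity_four hR (isRegularScale_zero (by norm_num)) (hm0 2) (n := 3)
      (by norm_num) fun b hb => ?_
    rcases Nat.lt_succ_iff_lt_or_eq.1 hb with hb | rfl
    · exact p0 2 b (by norm_num) (by exact_mod_cast hb)
    · exact D.exists_dev_eq_top hφ ht (by norm_num)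
  · intro k hk
    have hk' : (1 : ℤ) ≤ k := by exact_mod_cast hk
    have hkQ : (1 : ℚ) ≤ k := by exact_mod_cast hk
    -- The waves give the stronger bounds `k` and `k - 1`; for `k = 1` the second is `0`, equal to
    -- the required floor.
    have hceil : ⌈(k : ℚ) / 2⌉₊ ≤ k := Nat.ceil_le.2 (by linarith)
    have hfloor : ⌊(k : ℚ) / 2⌋₊ ≤ k - 1 := by
      have : ⌊(k : ℚ) / 2⌋₊ < k := (Nat.floor_lt (by positivity)).2 (by linarith)
      omega
    refine ⟨⟨hceil.trans ?_, hfloor.trans ?_⟩, hceil.trans ?_, hfloor.trans ?_⟩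
    · exact D.le_multiplicity_four hR (isRegularScale_zero hk') (hm0 k) (by omega)
        fun b hb => p0 k b hk' (by omega)
    · exact D.le_multiplicity_two hR (isRegularScale_zero hk') (hm0 k) (by omega)
        fun b hb => p0 k b hk' (by omega)
    · exact D.le_multiplicity_four hR (isRegularScale_diag hk') (hmd k) (by omega)
        fun b hb => pd k b hk' (by omega)
    · exact D.le_multiplicity_two hR (isRegularScale_diag hk') (hmd k) (by omega)
        fun b hb => pd k b hk' (by omega)
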